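/- Let $d\ge 0$, and let $|\cdot|$ be the maximum norm on $\mathbb{Z}^d$. Consider local Lindbladians on $\mathbb{Z}^d$ with local dephasing. Such a Lindbladian is given by - local self-adjoint Hamiltonian terms $h_i$ and local Lindblad operators $L_j$ on $\ell^2(\mathbb{Z}^d)$. Each term $A$ acts on a finite nonempty set $S_A\subset\mathbb{Z}^d$, that is, $\langle x|A|y\rangle=0$ unless $x,y\in S_A$. The sets $S_A$ have diameter at most $R$, the matrix elements satisfy $|\langle x|A|y\rangle|\le M$, and every site lies in at most $N$ of the sets $S_{h_i}$ and in at most $N$ of the sets $S_{L_j}$; - a dissipation strength $G>0$ and a dephasing rate $\gamma>0$. For finite $\Lambda\subset\mathbb{Z}^d$ put $H_\Lambda=\sum_{S_{h_i}\subset\Lambda}h_i$, $\mathcal{D}[L](\rho)=L\rho L^*-\tfrac12(L^*L\rho+\rho L^*L)$ and, for operators $\rho$ on $\ell^2(\Lambda)$, $$\mathcal{L}_\Lambda(\rho)=-i[H_\Lambda,\rho]+G\sum_{S_{L_j}\subset\Lambda}\mathcal{D}[L_j](\rho)+\gamma\sum_{k\in\Lambda}\mathcal{D}\big[|k\rangle\langle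 k|\big](\rho).$$ The non-Hermitian evolution $\mathcal{T}_\Lambda$ is $\mathcal{L}_\Lambda$ without the quantum jump terms, that is, with each $\mathcal{D}[L](\rho)$ replaced by $-\tfrac12(L^*L\rho+\rho L^*L)$. For a state (density matrix) $\rho_0$ on $\ell^2(\Lambda)$ and $\varepsilon>0$ the Abel average is $$\rho_\varepsilon=\varepsilon\int_0^\infty e^{-t\varepsilon}\,e^{t\mathcal{L}_\Lambda}(\rho_0)\,dt .$$ Write $\rho(x,y)=\langle x|\rho|y\rangle$. **Theorem.** Fix $d,R,N,M$ and $G,\gamma>0$. The non-Hermitian evolution has a uniform gap: there is $g>0$ such that, for every local Lindbladian with local dephasing as above and every finite $\Lambda\subset\mathbb{Z}^d$, every $z$ in the spectrum of $\mathcal{T}_\Lambda$ satisfies $\operatorname{Re}z\le -g$. Moreover there are constants $C,\mu>0$, and for each $s\in(0,1)$ a constant $C_s>0$, such that for every such Lindbladian, every finite $\Lambda\subset\mathbb{Z}^d$, all $x,y\in\Lambda$, every initial state $\rho_0$ and every $\varepsilon\in(0,1)$, $$|\rho_\varepsilon(x,y)|\le Ce^{-\mu|x-y|}+C_s\,\varepsilon^{2s-1}.$$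 In particular, with the same $C,\mu$, every steady state $\rho_\infty$ of $\mathcal{L}_\Lambda$ (a state with $\mathcal{L}_\Lambda(\rho_\infty)=0$) satisfies $$|\rho_\infty(x,y)|\le Ce^{-\mu|x-y|}\qquad\text{for all }x,y\in\Lambda .$$ All constants depend only on $d,R,N,M,G,\gamma$ (and $C_s$ also on $s$). -/

import Mathlib

open scoped Nat Matrix ComplexOrder

universe u v

/-- Sites of the lattice `ℤ^d`.  The norm `‖x - y‖` of sites is the maximum norm. -/
abbrev Site (d : ℕ) : Type := Fin d → ℤ

/-- A family of local operators on `ℓ²(ℤ^d)`, given by their matrix elements in the position basis: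
the `i`-th operator acts on the finite region `supp i`, the regions have diameter at most `R`, at
most `N` of them contain a given site, and all matrix elements are bounded by `M`. -/
structure LocalTerms (d : ℕ) (ι : Type*) (R : ℝ) (N : ℕ) (M : ℝ) where
  op : ι → Matrix (Site d) (Site d) ℂ
  supp : ι → Finset (Site d)
  supp_nonempty : ∀ i, (supp i).Nonempty
  op_eq_zero : ∀ i x y, ¬(x ∈ supp i ∧ y ∈ supp i) → op i x y = 0
  diam_le : ∀ i, ∀ x ∈ supp i, ∀ y ∈ supp i, ‖x - y‖ ≤ R
  encard_le : ∀ x, {i | x ∈ supp i}.encard ≤ N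
  norm_op_le : ∀ i x y, ‖op i x y‖ ≤ M

namespace LocalTerms

variable {d : ℕ} {ι : Type*} {R : ℝ} {N : ℕ} {M : ℝ}

theorem finite_inside (T : LocalTerms d ι R N M) (Λ : Finset (Site d)) :
    {i | T.supp i ⊆ Λ}.Finite := by
  refine Set.Finite.subset (s := ⋃ x ∈ (Λ : Set (Site d)), {i | x ∈ T.supp i}) ?_ ?_
  · refine Set.Finite.biUnion Λ.finite_toSet fun x _ => ?_
    exact Set.finite_of_encard_le_coe (T.encard_le x)
  · intro i hi
    obtain ⟨x, hx⟩ := T.supp_nonempty i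
    simp only [Set.mem_iUnion]
    exact ⟨x, hi hx, hx⟩

/-- The (finitely many) terms of the family that act inside `Λ`. -/
noncomputable def inside (T : LocalTerms d ι R N M) (Λ : Finset (Site d)) : Finset ι :=
  (T.finite_inside Λ).toFinset

/-- The `i`-th term as an operator on `ℓ²(Λ)`. -/
def onRegion (T : LocalTerms d ι R N M) (Λ : Finset (Site d)) (i : ι) : Matrix Λ Λ ℂ :=
  (T.op i).submatrix Subtype.val Subtype.val

end LocalTerms

section Lindblad

variable {n : Type*} [Fintype n] [DecidableEq n]

/-- The commutator part `ρ ↦ -i [H, ρ]`. -/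
noncomputable def hamiltonianPart (H : Matrix n n ℂ) : Module.End ℂ (Matrix n n ℂ) where
  toFun ρ := -Complex.I • (H * ρ - ρ * H)
  map_add' ρ σ := by rw [← smul_add]; congr 1; noncomm_ring
  map_smul' c ρ := by
    simp only [Matrix.mul_smul, Matrix.smul_mul, ← smul_sub, RingHom.id_apply]
    rw [smul_comm]

/-- The quantum jump part `ρ ↦ L ρ L*`. -/
noncomputable def jumpPart (L : Matrix n n ℂ) : Module.End ℂ (Matrix n n ℂ) where
  toFun ρ := L * ρ * Lᴴ
  map_add' ρ σ := by noncomm_ring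
  map_smul' c ρ := by simp only [Matrix.mul_smul, Matrix.smul_mul, RingHom.id_apply]

/-- The part `ρ ↦ -½ (L* L ρ + ρ L* L)`. -/
noncomputable def decayPart (L : Matrix n n ℂ) : Module.End ℂ (Matrix n n ℂ) where
  toFun ρ := -(1 / 2 : ℂ) • (Lᴴ * L * ρ + ρ * (Lᴴ * L))
  map_add' ρ σ := by rw [← smul_add]; congr 1; noncomm_ring
  map_smul' c ρ := by
    simp only [Matrix.mul_smul, Matrix.smul_mul, ← smul_add, RingHom.id_apply]
    rw [smul_comm]

/-- The dissipator `ρ ↦ L ρ L* - ½ (L* L ρ + ρ L* L)` of a Lindblad operator `L`. -/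
noncomputable def dissipator (L : Matrix n n ℂ) : Module.End ℂ (Matrix n n ℂ) :=
  jumpPart L + decayPart L

/-- The projection `|k⟩⟨k|`, which is the Lindblad operator of dephasing at the site `k`. -/
def siteProj (k : n) : Matrix n n ℂ := Matrix.single k k 1

/-- Quantum states (density matrices). -/
def IsState (ρ : Matrix n n ℂ) : Prop := ρ.PosSemidef ∧ ρ.trace = 1

/-- Steady states of the evolution generated by `A`. -/
def IsSteadyState (A : Module.End ℂ (Matrix n n ℂ)) (ρ : Matrix n n ℂ) : Prop :=
  IsState ρ ∧ A ρ = 0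

/-- The time evolution `e^{tA}(ρ) = ∑ₖ (t^k / k!) A^k(ρ)`. -/
noncomputable def evolve (A : Module.End ℂ (Matrix n n ℂ)) (t : ℝ) (ρ : Matrix n n ℂ) :
    Matrix n n ℂ :=
  ∑' k : ℕ, ((t : ℂ) ^ k / (k ! : ℂ)) • (A ^ k) ρ

/-- The Abel average `ε ∫₀^∞ e^{-tε} e^{tA}(ρ₀) dt` (the integral is taken entrywise). -/
noncomputable def abelAverage (A : Module.End ℂ (Matrix n n ℂ)) (ε : ℝ) (ρ₀ : Matrix n n ℂ) :
    Matrix n n ℂ :=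
  Matrix.of fun x y =>
    (ε : ℂ) * ∫ t in Set.Ioi (0 : ℝ), (Real.exp (-(t * ε)) : ℂ) * evolve A t ρ₀ x y

end Lindblad

/-- The data of a local Lindbladian on `ℤ^d`: a Hamiltonian that is a sum of local self-adjoint
terms, and local Lindblad operators. -/
structure LocalLindbladian (d : ℕ) (ι κ : Type*) (R : ℝ) (N : ℕ) (M : ℝ) where
  ham : LocalTerms d ι R N M
  ham_isHermitian : ∀ i, (ham.op i).IsHermitian
  lind : LocalTerms d κ R N M

namespace LocalLindbladian

variable {d : ℕ} {ι κ : Type*} {R : ℝ} {N : ℕ} {M : ℝ}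

/-- The Hamiltonian of the region `Λ`. -/
noncomputable def hamiltonian (𝓛 : LocalLindbladian d ι κ R N M) (Λ : Finset (Site d)) :
    Matrix Λ Λ ℂ :=
  ∑ i ∈ 𝓛.ham.inside Λ, 𝓛.ham.onRegion Λ i

/-- The Lindbladian of the region `Λ`, with dissipation strength `G`, and with local dephasing of
rate `γ` at every site. -/
noncomputable def generator (𝓛 : LocalLindbladian d ι κ R N M) (G γ : ℝ) (Λ : Finset (Site d)) :
    Module.End ℂ (Matrix Λ Λ ℂ) :=
  hamiltonianPart (𝓛.hamiltonian Λ)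
    + (G : ℂ) • ∑ j ∈ 𝓛.lind.inside Λ, dissipator (𝓛.lind.onRegion Λ j)
    + (γ : ℂ) • ∑ k : Λ, dissipator (siteProj k)

/-- The non-Hermitian evolution of the region `Λ`: the generator without the quantum jump terms. -/
noncomputable def nonHermitian (𝓛 : LocalLindbladian d ι κ R N M) (G γ : ℝ)
    (Λ : Finset (Site d)) : Module.End ℂ (Matrix Λ Λ ℂ) :=
  hamiltonianPart (𝓛.hamiltonian Λ)
    + (G : ℂ) • ∑ j ∈ 𝓛.lind.inside Λ, decayPart (𝓛.lind.onRegion Λ j)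
    + (γ : ℂ) • ∑ k : Λ, decayPart (siteProj k)

end LocalLindbladian

/-! Split the Lindbladian into the non-Hermitian evolution and the jumps. Since the projections
`|k⟩⟨k|` sum to the identity, dephasing adds exactly `-γρ` to the former, which becomes `ρ ↦ Bρ +
ρB* - γρ` with `B = -iH - (G/2) ∑ L*L` (`nonHermitian_apply`). `B` is dissipative, so in the
Hilbert-Schmidt inner product this map has real part at most `-γ`, which is the gap.

The Abel average is a state `ρ` with `𝓛ρ = ε(ρ - ρ₀)` (`abelAverage_isState_and_map`), and a steady
state solves this with `ε = 0`. Hence `ρ` is the resolvent at `ε` of the non-Hermitian evolution,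
applied to `J(ρ) + ερ₀`, where `J(ρ)` collects the jumps. Whatever `ρ` is, `J(ρ)` is supported near
the diagonal (`jump_eq_zero`); it is positive with trace bounded uniformly in `Λ`
(`norm_trace_jump_le`), so its Hilbert-Schmidt norm is bounded too. A Combes-Thomas argument shows
that the resolvent stays bounded in the weight `e^{μ|x-y|}` for small `μ`
(`weighted_resolvent_bound`), so the `J(ρ)` part decays exponentially. The `ερ₀` part has no decay
but costs at most `ε/γ`, which is stronger than `ε^{2s-1}`. -/

section Semigroup

open Filter Topology
open scoped Matrix.Norms.Elementwise
open MeasureTheory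

/-! ### Euler products for the exponential -/

section Euler

variable {𝔸 : Type*} [NormedRing 𝔸] [NormOneClass 𝔸]

/-- Telescoping. Taking `K ≥ 1` permits the crude factor `K ^ n` in place of `K ^ (n - 1)`. -/
theorem norm_pow_sub_pow_le_of_norm_le {a b : 𝔸} {K : ℝ} (ha : ‖a‖ ≤ K) (hb : ‖b‖ ≤ K)
    (hK : 1 ≤ K) (n : ℕ) : ‖a ^ n - b ^ n‖ ≤ n * K ^ n * ‖a - b‖ := by
  induction n with
  | zero => simp
  | succ n ih =>
    have hK0 : 0 ≤ K := zero_le_one.trans hK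
    have e : a ^ (n + 1) - b ^ (n + 1) = a ^ n * (a - b) + (a ^ n - b ^ n) * b := by
      rw [pow_succ, pow_succ]; noncomm_ring
    have h1 : ‖a ^ n‖ ≤ K ^ n := (norm_pow_le a n).trans (pow_le_pow_left₀ (norm_nonneg _) ha n)
    have h2 : K ^ n ≤ K ^ (n + 1) := pow_le_pow_right₀ hK (Nat.le_succ n)
    calc ‖a ^ (n + 1) - b ^ (n + 1)‖ ≤ ‖a ^ n‖ * ‖a - b‖ + ‖a ^ n - b ^ n‖ * ‖b‖ := by
          rw [e]
          exact (norm_add_le _ _).trans (add_le_add (norm_mul_le _ _) (norm_mul_le _ _))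
      _ ≤ K ^ (n + 1) * ‖a - b‖ + (n * K ^ n * ‖a - b‖) * K := by
          gcongr
          exact h1.trans h2
      _ = (n + 1 : ℕ) * K ^ (n + 1) * ‖a - b‖ := by push_cast; ring

variable [NormedAlgebra ℝ 𝔸] [CompleteSpace 𝔸]

theorem norm_exp_le_exp_norm (X : 𝔸) :
    ‖NormedSpace.exp X‖ ≤ Real.exp ‖X‖ := by
  have h1 := NormedSpace.exp_series_hasSum_exp' (𝕂 := ℝ) X
  have h2 := NormedSpace.exp_series_hasSum_exp' (𝕂 := ℝ) ‖X‖
  rw [← Real.exp_eq_exp_ℝ] at h2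
  rw [← h1.tsum_eq]
  refine tsum_of_norm_bounded h2 fun k => ?_
  rw [norm_smul, Real.norm_of_nonneg (by positivity), smul_eq_mul]
  exact mul_le_mul_of_nonneg_left (norm_pow_le X k) (by positivity)

/-- The Euler product formula `(1 + (t/n) X + (t/n)² Y)ⁿ → e^{tX}`. -/
theorem tendsto_euler_pow (X Y : 𝔸) {t : ℝ} (ht : 0 ≤ t) :
    Tendsto (fun n : ℕ => (1 + (t / n) • X + (t / n) ^ 2 • Y) ^ n) atTop
      (𝓝 (NormedSpace.exp (t • X))) := by
  have hlim : Tendsto (fun n : ℕ => t / n) atTop (𝓝 0) :=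
    tendsto_const_div_atTop_nhds_zero_nat t
  set Φ : ℝ → 𝔸 := fun h => 1 + h • X + h ^ 2 • Y with hΦ
  -- The Euler step and `e^{hX}` agree to first order, whatever `Y` is, so they differ by `o(h)`;
  -- the `n` steps of size `t/n` then accumulate an error `n · o(1/n)`.
  have hd : HasDerivAt (fun h : ℝ => Φ h - NormedSpace.exp (h • X)) 0 0 := by
    have h1 : HasDerivAt Φ X 0 := by
      have := (((hasDerivAt_id (0 : ℝ)).smul_const X).const_add 1).add
        (((hasDerivAt_id (0 : ℝ)).pow 2).smul_const Y)
      simp only [Nat.cast_ofNat, id_eq] at this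
      convert! this using 1
      simp
    have h2 := hasDerivAt_exp_smul_const (𝕂 := ℝ) X (0 : ℝ)
    simpa [Pi.sub_def] using h1.sub h2
  have ho : (fun h : ℝ => Φ h - NormedSpace.exp (h • X)) =o[𝓝 0] fun h : ℝ => h := by
    have := hd.isLittleO
    simpa [hΦ] using this
  set c := ‖X‖ + ‖Y‖
  have hc0 : 0 ≤ c := by positivity
  have hbound : ∀ᶠ n : ℕ in atTop,
      ‖Φ (t / n) ^ n - NormedSpace.exp (t • X)‖ ≤
        Real.exp (t * c) * (n * ‖Φ (t / n) - NormedSpace.exp ((t / n) • X)‖) := by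
    have hsmall : ∀ᶠ n : ℕ in atTop, t / n < 1 := hlim.eventually (gt_mem_nhds one_pos)
    filter_upwards [hsmall, eventually_gt_atTop 0] with n hn hn0
    have hn0' : (n : ℝ) ≠ 0 := by positivity
    have hh : 0 ≤ t / n := by positivity
    set h := t / n with hh_def
    have e1 : NormedSpace.exp (t • X) = NormedSpace.exp (h • X) ^ n := by
      let _ : NormedAlgebra ℚ 𝔸 := NormedAlgebra.restrictScalars ℚ ℝ 𝔸
      rw [← NormedSpace.exp_nsmul, ← Nat.cast_smul_eq_nsmul ℝ, smul_smul, hh_def,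
        mul_div_cancel₀ _ hn0']
    have b1 : ‖Φ h‖ ≤ Real.exp (h * c) := by
      calc ‖Φ h‖ ≤ ‖(1 : 𝔸)‖ + ‖h • X‖ + ‖h ^ 2 • Y‖ := norm_add₃_le
        _ = 1 + h * ‖X‖ + h ^ 2 * ‖Y‖ := by
            rw [norm_smul, norm_smul, norm_one, Real.norm_of_nonneg hh,
              Real.norm_of_nonneg (by positivity)]
        _ ≤ h * c + 1 := by
            -- Here `h < 1` is used: the quadratic term is absorbed into the linear rate `c`.
            have : h ^ 2 * ‖Y‖ ≤ h * ‖Y‖ :=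
              mul_le_mul_of_nonneg_right (by nlinarith) (norm_nonneg _)
            simp only [c]; nlinarith
        _ ≤ _ := Real.add_one_le_exp _
    have b2 : ‖NormedSpace.exp (h • X)‖ ≤ Real.exp (h * c) := by
      refine (norm_exp_le_exp_norm _).trans (Real.exp_le_exp.2 ?_)
      rw [norm_smul, Real.norm_of_nonneg hh]
      exact mul_le_mul_of_nonneg_left (by simp [c]) hh
    have := norm_pow_sub_pow_le_of_norm_le b1 b2 (Real.one_le_exp (by positivity)) n
    rw [e1]
    refine this.trans (le_of_eq ?_)
    rw [← Real.exp_nat_mul, hh_def]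
    have : (n : ℝ) * (t / n * c) = t * c := by field_simp
    rw [this]; ring
  have hz : Tendsto (fun n : ℕ => (n : ℝ) * ‖Φ (t / n) - NormedSpace.exp ((t / n) • X)‖)
      atTop (𝓝 0) := by
    have h1 : (fun n : ℕ => Φ (t / n) - NormedSpace.exp ((t / n) • X)) =o[atTop]
        fun n : ℕ => t / (n : ℝ) := ho.comp_tendsto hlim
    have h2 : (fun n : ℕ => t / (n : ℝ)) =O[atTop] fun n : ℕ => ((n : ℝ)⁻¹) := by
      simp only [div_eq_mul_inv]
      exact Asymptotics.isBigO_const_mul_self _ _ _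
    have h3 := (h1.trans_isBigO h2).norm_left.tendsto_div_nhds_zero
    simpa [div_eq_mul_inv, mul_comm] using h3
  rw [tendsto_iff_norm_sub_tendsto_zero]
  refine squeeze_zero' (.of_forall fun _ => norm_nonneg _) hbound ?_
  simpa using hz.const_mul (Real.exp (t * c))

end Euler

/-! ### Orbits of `e^{tA}` and their Laplace transform -/

section ExpAction

variable {E : Type*} [NormedAddCommGroup E] [NormedSpace ℂ E] [FiniteDimensional ℂ E]

/-- The action of the exponential `e^{tA}` on a vector. -/
noncomputable def expAction (A : Module.End ℂ E) (t : ℝ) (v : E) : E :=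
  NormedSpace.exp (t • LinearMap.toContinuousLinearMap A) v

theorem toContinuousLinearMap_pow_apply (A : Module.End ℂ E) (k : ℕ) (v : E) :
    (LinearMap.toContinuousLinearMap A ^ k) v = (A ^ k) v := by
  induction k generalizing v with
  | zero => simp
  | succ k ih =>
    rw [pow_succ, pow_succ, mul_apply_eq_comp, Module.End.mul_apply]
    exact ih _

theorem hasSum_expAction (A : Module.End ℂ E) (t : ℝ) (v : E) :
    HasSum (fun k : ℕ => ((t : ℂ) ^ k / (k ! : ℂ)) • (A ^ k) v) (expAction A t v) := by
  have := FiniteDimensional.complete ℂ E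
  have h := NormedSpace.exp_series_hasSum_exp' (𝕂 := ℂ) (t • LinearMap.toContinuousLinearMap A)
  have h' := h.mapL (ContinuousLinearMap.apply ℂ E v)
  convert! h' using 2 with k
  rw [← Complex.coe_smul, smul_pow]
  simp only [ContinuousLinearMap.apply_apply, FunLike.coe_smul, Pi.smul_apply,
    toContinuousLinearMap_pow_apply, smul_smul]
  rw [div_eq_inv_mul]

theorem expAction_zero (A : Module.End ℂ E) (v : E) : expAction A 0 v = v := by
  simp [expAction]

theorem hasDerivAt_expAction (A : Module.End ℂ E) (t : ℝ) (v : E) :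
    HasDerivAt (fun t => expAction A t v) (A (expAction A t v)) t := by
  have := FiniteDimensional.complete ℂ E
  have h := hasDerivAt_exp_smul_const' (𝕂 := ℝ) (LinearMap.toContinuousLinearMap A) t
  have h' := ((ContinuousLinearMap.apply ℂ E v).restrictScalars ℝ).hasFDerivAt.comp_hasDerivAt t h
  exact h'

/-- Every term of the exponential series beyond the zeroth lies in the range of `A`. Applied to the
trace. -/
theorem map_expAction (A : Module.End ℂ E) (ℓ : E →ₗ[ℂ] ℂ) (h : ∀ v, ℓ (A v) = 0) (t : ℝ) (v : E) :
    ℓ (expAction A t v) = ℓ v := by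
  have hs := (hasSum_expAction A t v).mapL (LinearMap.toContinuousLinearMap ℓ)
  refine hs.unique ?_
  have := hasSum_single (f := fun k : ℕ => LinearMap.toContinuousLinearMap ℓ
    (((t : ℂ) ^ k / (k ! : ℂ)) • (A ^ k) v)) 0 ?_
  · simpa using this
  · intro k hk
    obtain ⟨k, rfl⟩ := Nat.exists_eq_succ_of_ne_zero hk
    simp [pow_succ', h]

/-- A closed set that is invariant under the Euler steps `v ↦ v + hAv + h²Yv` is invariant under
`e^{tA}`. -/
theorem expAction_mem [Nontrivial E] {A Y : Module.End ℂ E} {K : Set E} (hK : IsClosed K)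
    (hstep : ∀ h : ℝ, 0 ≤ h → ∀ v ∈ K, v + h • A v + h ^ 2 • Y v ∈ K) {t : ℝ} (ht : 0 ≤ t) {v : E}
    (hv : v ∈ K) : expAction A t v ∈ K := by
  have := FiniteDimensional.complete ℂ E
  have hE := tendsto_euler_pow (LinearMap.toContinuousLinearMap A)
    (LinearMap.toContinuousLinearMap Y) ht
  have hE' := ((ContinuousLinearMap.apply ℂ E v).continuous.tendsto _).comp hE
  refine hK.mem_of_tendsto hE' (.of_forall fun m => ?_)
  have hpow : ∀ k : ℕ, ((1 + (t / m) • LinearMap.toContinuousLinearMap A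
      + (t / m) ^ 2 • LinearMap.toContinuousLinearMap Y) ^ k) v ∈ K := by
    intro k
    induction k with
    | zero => simpa using hv
    | succ k ih =>
      rw [pow_succ', mul_apply_eq_comp]
      exact hstep _ (by positivity) _ ih
  exact hpow m

variable {A : Module.End ℂ E} {v : E} {C ε : ℝ}

theorem continuous_expAction (A : Module.End ℂ E) (v : E) :
    Continuous fun t => expAction A t v :=
  continuous_iff_continuousAt.2 fun t => (hasDerivAt_expAction A t v).continuousAt

theorem integrableOn_exp_smul_expAction (hC : ∀ t, 0 ≤ t → ‖expAction A t v‖ ≤ C) (hε : 0 < ε) :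
    IntegrableOn (fun t : ℝ => Real.exp (-(t * ε)) • expAction A t v) (Set.Ioi 0) := by
  have hi : IntegrableOn (fun t : ℝ => Real.exp (-ε * t) * C) (Set.Ioi 0) :=
    (exp_neg_integrableOn_Ioi 0 hε).mul_const C
  have hc : Continuous fun t : ℝ => Real.exp (-(t * ε)) • expAction A t v :=
    (by fun_prop : Continuous fun t : ℝ => Real.exp (-(t * ε))).smul (continuous_expAction A v)
  refine hi.mono' hc.aestronglyMeasurable ?_
  refine (ae_restrict_iff' measurableSet_Ioi).2 (.of_forall fun t ht => ?_)
  rw [norm_smul, Real.norm_of_nonneg (Real.exp_pos _).le]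
  have e : -(t * ε) = -ε * t := by ring
  rw [e]
  exact mul_le_mul_of_nonneg_left (hC t (le_of_lt ht)) (Real.exp_pos _).le

theorem map_integral_eq (ℓ : E →ₗ[ℂ] ℂ) (hC : ∀ t, 0 ≤ t → ‖expAction A t v‖ ≤ C) (hε : 0 < ε) :
    ℓ (∫ t in Set.Ioi (0 : ℝ), Real.exp (-(t * ε)) • expAction A t v) =
      ∫ t in Set.Ioi (0 : ℝ), (Real.exp (-(t * ε)) : ℂ) * ℓ (expAction A t v) := by
  have := FiniteDimensional.complete ℂ E
  have := ContinuousLinearMap.integral_comp_comm (LinearMap.toContinuousLinearMap ℓ)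
    (integrableOn_exp_smul_expAction hC hε)
  refine this.symm.trans (integral_congr_ae (.of_forall fun t => ?_))
  simp only [← Complex.coe_smul]
  exact map_smul ℓ _ _

/-- The Laplace transform of a bounded orbit of `e^{tA}` solves the resolvent equation. -/
theorem map_integral_exp_smul_expAction (hC : ∀ t, 0 ≤ t → ‖expAction A t v‖ ≤ C) (hε : 0 < ε) :
    A (∫ t in Set.Ioi (0 : ℝ), Real.exp (-(t * ε)) • expAction A t v) =
      ε • (∫ t in Set.Ioi (0 : ℝ), Real.exp (-(t * ε)) • expAction A t v) - v := by
  have := FiniteDimensional.complete ℂ E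
  have hi := integrableOn_exp_smul_expAction hC hε
  set F := fun t : ℝ => Real.exp (-(t * ε)) • expAction A t v with hF
  set Ac := (LinearMap.toContinuousLinearMap A) with hAc
  -- The weighted orbit satisfies `F' = AF - εF` and tends to zero; integrating over the half-line
  -- gives the resolvent equation.
  have hd : ∀ t ∈ Set.Ici (0 : ℝ), HasDerivAt F (Ac (F t) - ε • F t) t := fun t _ => by
    have h1 : HasDerivAt (fun t : ℝ => Real.exp (-(t * ε))) (Real.exp (-(t * ε)) * (-(1 * ε))) t :=
      ((hasDerivAt_id t).mul_const ε).neg.exp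
    have h2 := h1.smul (hasDerivAt_expAction A t v)
    refine h2.congr_deriv ?_
    simp only [hF, hAc, ← Complex.coe_smul, map_smul, LinearMap.coe_toContinuousLinearMap',
      smul_smul]
    rw [sub_eq_add_neg, ← neg_smul]
    congr 2
    push_cast; ring
  have hlim : Tendsto F atTop (𝓝 0) := by
    have he : Tendsto (fun t : ℝ => Real.exp (-(t * ε)) * C) atTop (𝓝 0) := by
      have := (Real.tendsto_exp_neg_atTop_nhds_zero.comp
        (tendsto_id.atTop_mul_const hε)).mul_const C
      simpa using this
    refine squeeze_zero_norm' ?_ he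
    filter_upwards [eventually_ge_atTop 0] with t ht
    rw [hF, norm_smul, Real.norm_of_nonneg (Real.exp_pos _).le]
    exact mul_le_mul_of_nonneg_left (hC t ht) (Real.exp_pos _).le
  have hi1 : IntegrableOn (fun t => Ac (F t)) (Set.Ioi 0) := Ac.integrable_comp hi
  have hi2 : IntegrableOn (fun t => ε • F t) (Set.Ioi 0) := hi.smul ε
  have h := integral_Ioi_of_hasDerivAt_of_tendsto' hd (hi1.sub hi2) hlim
  rw [integral_sub hi1 hi2, integral_smul, ContinuousLinearMap.integral_comp_comm Ac hi] at h
  have h0 : F 0 = v := by simp [hF, expAction_zero]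
  rw [h0, zero_sub] at h
  rw [eq_sub_iff_add_eq, ← sub_eq_zero]
  have h' : Ac (∫ t in Set.Ioi (0 : ℝ), F t) - ε • (∫ t in Set.Ioi (0 : ℝ), F t) + v = 0 := by
    rw [h]; simp
  rw [← h', hAc, LinearMap.coe_toContinuousLinearMap']
  abel

end ExpAction

/-! ### Entries of positive matrices -/

section PosSemidef

variable {n : Type*}

/-- The principal `2 × 2` minor on `x, y` has nonnegative determinant. -/
theorem Matrix.PosSemidef.norm_apply_sq_le {X : Matrix n n ℂ} (hX : X.PosSemidef) (x y : n) :
    ‖X x y‖ ^ 2 ≤ (X x x).re * (X y y).re := by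
  have h := (hX.submatrix ![x, y]).det_nonneg
  rw [Matrix.det_fin_two] at h
  have hxx := Complex.nonneg_iff.1 (hX.diag_nonneg (i := x))
  have hyy := Complex.nonneg_iff.1 (hX.diag_nonneg (i := y))
  have hyx : X y x = star (X x y) := (hX.isHermitian.apply y x).symm
  have h' := (Complex.nonneg_iff.1 h).1
  simp only [Matrix.submatrix_apply, Matrix.cons_val_zero, Matrix.cons_val_one, hyx,
    Complex.star_def, Complex.mul_conj, Complex.sub_re, Complex.mul_re, Complex.ofReal_re,
    ← hxx.2] at h'
  rw [Complex.normSq_eq_norm_sq] at h'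
  linarith

theorem Matrix.PosSemidef.re_diag_nonneg {X : Matrix n n ℂ} (hX : X.PosSemidef) (x : n) :
    0 ≤ (X x x).re := (Complex.nonneg_iff.1 (hX.diag_nonneg (i := x))).1

theorem Matrix.PosSemidef.norm_apply_le {X : Matrix n n ℂ} (hX : X.PosSemidef) (x y : n) :
    ‖X x y‖ ≤ ((X x x).re + (X y y).re) / 2 := by
  refine abs_le_of_sq_le_sq' ?_ ?_ |>.2
  · nlinarith [hX.norm_apply_sq_le x y, sq_nonneg ((X x x).re - (X y y).re)]
  · linarith [hX.re_diag_nonneg x, hX.re_diag_nonneg y]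

variable [Fintype n]

/-- The Hilbert-Schmidt norm of a positive matrix is bounded by its trace. -/
theorem Matrix.PosSemidef.sum_norm_sq_le {X : Matrix n n ℂ} (hX : X.PosSemidef) :
    ∑ x, ∑ y, ‖X x y‖ ^ 2 ≤ X.trace.re ^ 2 := by
  calc ∑ x, ∑ y, ‖X x y‖ ^ 2 ≤ ∑ x, ∑ y, (X x x).re * (X y y).re :=
        Finset.sum_le_sum fun x _ => Finset.sum_le_sum fun y _ => hX.norm_apply_sq_le x y
    _ = X.trace.re ^ 2 := by
        rw [sq, Matrix.trace, Complex.re_sum, Finset.sum_mul_sum]; rfl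

/-- Gives the bound, uniform in time, under which the Laplace integral of an orbit of states
converges. -/
theorem IsState.norm_apply_le_one {ρ : Matrix n n ℂ} (h : IsState ρ) (x y : n) :
    ‖ρ x y‖ ≤ 1 := by
  have hs : ∑ z, (ρ z z).re = 1 := by
    have := congrArg Complex.re h.2
    rwa [Matrix.trace, Complex.re_sum] at this
  have hle : ∀ z, (ρ z z).re ≤ 1 := fun z => by
    rw [← hs]
    exact Finset.single_le_sum (f := fun z => (ρ z z).re) (fun i _ => h.1.re_diag_nonneg i)
      (Finset.mem_univ z)
  linarith [h.1.norm_apply_le x y, hle x, hle y]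

theorem isClosed_posSemidef : IsClosed {X : Matrix n n ℂ | X.PosSemidef} := by
  have : {X : Matrix n n ℂ | X.PosSemidef} =
      {X | Xᴴ = X} ∩ ⋂ v : n → ℂ, {X | 0 ≤ star v ⬝ᵥ (X *ᵥ v)} := by
    ext X
    simp only [Set.mem_ofPred_eq, Set.mem_inter_iff, Set.mem_iInter]
    exact Matrix.posSemidef_iff_dotProduct_mulVec
  rw [this]
  refine (isClosed_eq (by fun_prop) continuous_id).inter (isClosed_iInter fun v => ?_)
  exact isClosed_le continuous_const (by fun_prop)

end PosSemidef

/-! ### Positivity, trace and Abel averages -/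

section Evolve

variable {n : Type*} [Fintype n]

theorem evolve_eq_expAction (A : Module.End ℂ (Matrix n n ℂ)) (t : ℝ) (ρ : Matrix n n ℂ) :
    evolve A t ρ = expAction A t ρ :=
  (hasSum_expAction A t ρ).tsum_eq

/-- The Abel average of a positive trace preserving evolution is a state, and it solves the
resolvent equation. -/
theorem abelAverage_isState_and_map {A : Module.End ℂ (Matrix n n ℂ)} {ρ : Matrix n n ℂ}
    (h : ∀ t, 0 ≤ t → IsState (evolve A t ρ)) {ε : ℝ} (hε : 0 < ε) :
    IsState (abelAverage A ε ρ) ∧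
      A (abelAverage A ε ρ) = (ε : ℂ) • (abelAverage A ε ρ - ρ) := by
  have hC : ∀ t, 0 ≤ t → ‖expAction A t ρ‖ ≤ 1 := fun t ht => by
    rw [← evolve_eq_expAction, Matrix.norm_le_iff zero_le_one]
    exact (h t ht).norm_apply_le_one
  have hi := integrableOn_exp_smul_expAction hC hε
  set I := ∫ t in Set.Ioi (0 : ℝ), Real.exp (-(t * ε)) • expAction A t ρ with hI
  have hmap : ∀ ℓ : Matrix n n ℂ →ₗ[ℂ] ℂ,
      ℓ I = ∫ t in Set.Ioi (0 : ℝ), (Real.exp (-(t * ε)) : ℂ) * ℓ (evolve A t ρ) := fun ℓ => by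
    simp only [evolve_eq_expAction]
    exact map_integral_eq ℓ hC hε
  have hav : abelAverage A ε ρ = (ε : ℂ) • I := by
    ext x y
    rw [Matrix.smul_apply, smul_eq_mul]
    exact congrArg (fun z => (ε : ℂ) * z) (hmap (Matrix.entryLinearMap ℂ ℂ x y)).symm
  have hres : A I = (ε : ℂ) • I - ρ := by
    rw [Complex.coe_smul]
    exact map_integral_exp_smul_expAction hC hε
  have hA2 : A (abelAverage A ε ρ) = (ε : ℂ) • (abelAverage A ε ρ - ρ) := by
    rw [hav, map_smul, hres]
  have hexp : ∫ t in Set.Ioi (0 : ℝ), Real.exp (-(t * ε)) = ε⁻¹ := by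
    simpa [mul_comm, neg_div, div_neg] using integral_exp_mul_Ioi (neg_lt_zero.2 hε) 0
  refine ⟨⟨?_, ?_⟩, hA2⟩
  · rw [hav]
    refine Matrix.PosSemidef.smul ?_ (by exact_mod_cast hε.le)
    refine Matrix.PosSemidef.of_dotProduct_mulVec_nonneg ?_ fun v => ?_
    · ext x y
      have h1 := hmap (Matrix.entryLinearMap ℂ ℂ x y)
      have h2 := hmap (Matrix.entryLinearMap ℂ ℂ y x)
      simp only [Matrix.entryLinearMap_apply] at h1 h2
      rw [Matrix.conjTranspose_apply, h1, h2, Complex.star_def, ← integral_conj]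
      refine setIntegral_congr_fun measurableSet_Ioi fun t ht => ?_
      have := (h t (le_of_lt ht)).1.isHermitian.apply x y
      simp only [map_mul, Complex.conj_ofReal]
      rw [← this, Complex.star_def]
    · let q : Matrix n n ℂ →ₗ[ℂ] ℂ :=
        { toFun := fun X => star v ⬝ᵥ (X *ᵥ v)
          map_add' := fun X Y => by rw [Matrix.add_mulVec, dotProduct_add]
          map_smul' := fun c X => by rw [Matrix.smul_mulVec, dotProduct_smul]; rfl }
      have hq := hmap q
      change 0 ≤ q I
      rw [hq]
      refine integral_nonneg_of_ae ((ae_restrict_iff' measurableSet_Ioi).2 (.of_forall fun t ht => ?_))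
      exact mul_nonneg (by exact_mod_cast (Real.exp_pos _).le)
        ((h t (le_of_lt ht)).1.dotProduct_mulVec_nonneg v)
  · have := hmap (Matrix.traceLinearMap n ℂ ℂ)
    rw [setIntegral_congr_fun (g := fun t : ℝ => ((Real.exp (-(t * ε)) : ℝ) : ℂ)) measurableSet_Ioi
      (fun t ht => by simp [(h t (le_of_lt ht)).2]), integral_complex_ofReal, hexp] at this
    rw [hav, Matrix.trace_smul]
    change (ε : ℂ) • Matrix.traceLinearMap n ℂ ℂ I = 1
    rw [this, smul_eq_mul]
    push_cast
    exact mul_inv_cancel₀ (by exact_mod_cast hε.ne')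

variable [DecidableEq n]

/-- A generator `ρ ↦ Bρ + ρB* + J(ρ)`, with `J` a positive map, generates a positive evolution. -/
theorem evolve_posSemidef [Nonempty n] {A J : Module.End ℂ (Matrix n n ℂ)} {B : Matrix n n ℂ}
    (hA : ∀ ρ, A ρ = B * ρ + ρ * Bᴴ + J ρ) (hJ : ∀ ρ, ρ.PosSemidef → (J ρ).PosSemidef)
    {t : ℝ} (ht : 0 ≤ t) {ρ : Matrix n n ℂ} (hρ : ρ.PosSemidef) : (evolve A t ρ).PosSemidef := by
  rw [evolve_eq_expAction]
  refine expAction_mem (Y := jumpPart B) isClosed_posSemidef (fun h hh σ hσ => ?_) ht hρ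
  -- The second-order term `h²BσB*` completes the Euler step to a congruence plus a positive map, so
  -- each step preserves the closed positive cone.
  have e : σ + h • A σ + h ^ 2 • jumpPart B σ
      = (1 + (h : ℂ) • B) * σ * (1 + (h : ℂ) • B)ᴴ + (h : ℂ) • J σ := by
    simp only [← Complex.coe_smul]
    change σ + (h : ℂ) • A σ + ((h ^ 2 : ℝ) : ℂ) • (B * σ * Bᴴ) = _
    rw [hA]
    simp only [Matrix.conjTranspose_add, Matrix.conjTranspose_one, Matrix.conjTranspose_smul,
      Complex.star_def, Complex.conj_ofReal, add_mul, mul_add, one_mul, mul_one,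
      Matrix.smul_mul, Matrix.mul_smul, smul_add, smul_smul]
    push_cast
    rw [sq]
    abel
  change (σ + h • A σ + h ^ 2 • jumpPart B σ).PosSemidef
  rw [e]
  exact (hσ.mul_mul_conjTranspose_same _).add ((hJ σ hσ).smul (by exact_mod_cast hh))

theorem evolve_isState {A J : Module.End ℂ (Matrix n n ℂ)} {B : Matrix n n ℂ}
    (hA : ∀ ρ, A ρ = B * ρ + ρ * Bᴴ + J ρ) (hJ : ∀ ρ, ρ.PosSemidef → (J ρ).PosSemidef)
    (htr : ∀ ρ, (A ρ).trace = 0) {t : ℝ} (ht : 0 ≤ t) {ρ : Matrix n n ℂ} (hρ : IsState ρ) :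
    IsState (evolve A t ρ) := by
  -- Over an empty index set the trace vanishes, so there are no states.
  have : Nonempty n := by
    by_contra h
    have := not_nonempty_iff.1 h
    have := hρ.2
    simp [Matrix.trace] at this
  refine ⟨evolve_posSemidef hA hJ ht hρ.1, ?_⟩
  rw [evolve_eq_expAction, ← hρ.2]
  exact map_expAction A (Matrix.traceLinearMap n ℂ ℂ) htr t ρ

end Evolve

end Semigroup

/-! ### Weighted Hilbert-Schmidt estimates -/

section Energy

variable {n : Type*} [Fintype n]

/-- A dissipative matrix stays almost dissipative when it is conjugated with a slowly varying
weight (Schur test). -/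
theorem re_sum_weight_mulVec_le {B : Matrix n n ℂ} (hB : ∀ v : n → ℂ, (star v ⬝ᵥ (B *ᵥ v)).re ≤ 0)
    {b δ : ℝ} (hδ : 0 ≤ δ) (hrow : ∀ x, ∑ u, ‖B x u‖ ≤ b) (hcol : ∀ u, ∑ x, ‖B x u‖ ≤ b)
    {p : n → ℝ} (hp : ∀ x, 0 < p x) (hpB : ∀ x u, B x u ≠ 0 → |p x / p u - 1| ≤ δ) (η : n → ℂ) :
    (∑ x, (p x : ℂ) ^ 2 * (star (η x) * (B *ᵥ η) x)).re ≤ b * δ * ∑ x, p x ^ 2 * ‖η x‖ ^ 2 := by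
  set v : n → ℂ := fun x => p x * η x with hv
  have hvn : ∀ x, ‖v x‖ ^ 2 = p x ^ 2 * ‖η x‖ ^ 2 := fun x => by
    rw [hv, norm_mul, mul_pow, Complex.norm_real, Real.norm_of_nonneg (hp x).le]
  -- Conjugation by the weight turns `B x u` into `B x u * (p x / p u)`: the dissipative `B` plus an
  -- error with factor `p x / p u - 1`.
  have hsplit : ∑ x, (p x : ℂ) ^ 2 * (star (η x) * (B *ᵥ η) x) =
      star v ⬝ᵥ (B *ᵥ v) + ∑ x, ∑ u, star (v x) * (B x u * ((p x / p u - 1 : ℝ) : ℂ)) * v u := by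
    simp only [dotProduct, Matrix.mulVec, Finset.mul_sum, ← Finset.sum_add_distrib]
    refine Finset.sum_congr rfl fun x _ => Finset.sum_congr rfl fun u _ => ?_
    have hpu : (p u : ℂ) ≠ 0 := by exact_mod_cast (hp u).ne'
    simp only [hv, Pi.star_apply, star_mul', Complex.star_def, Complex.conj_ofReal]
    push_cast
    field_simp
    ring
  have hterm : ∀ x u, ‖star (v x) * (B x u * ((p x / p u - 1 : ℝ) : ℂ)) * v u‖ ≤
      δ / 2 * (‖B x u‖ * ‖v x‖ ^ 2) + δ / 2 * (‖B x u‖ * ‖v u‖ ^ 2) := by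
    intro x u
    rw [norm_mul, norm_mul, norm_mul, norm_star, Complex.norm_real, Real.norm_eq_abs]
    have h1 : ‖B x u‖ * |p x / p u - 1| ≤ ‖B x u‖ * δ := by
      by_cases h : B x u = 0
      · simp [h]
      · exact mul_le_mul_of_nonneg_left (hpB x u h) (norm_nonneg _)
    calc ‖v x‖ * (‖B x u‖ * |p x / p u - 1|) * ‖v u‖
        ≤ ‖v x‖ * (‖B x u‖ * δ) * ‖v u‖ := by gcongr
      _ = ‖B x u‖ * δ * (‖v x‖ * ‖v u‖) := by ring
      _ ≤ ‖B x u‖ * δ * ((‖v x‖ ^ 2 + ‖v u‖ ^ 2) / 2) := by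
          gcongr
          linarith [two_mul_le_add_sq ‖v x‖ ‖v u‖]
      _ = _ := by ring
  have herr : ‖∑ x, ∑ u, star (v x) * (B x u * ((p x / p u - 1 : ℝ) : ℂ)) * v u‖ ≤
      b * δ * ∑ x, ‖v x‖ ^ 2 := by
    calc _ ≤ ∑ x, ∑ u, (δ / 2 * (‖B x u‖ * ‖v x‖ ^ 2) + δ / 2 * (‖B x u‖ * ‖v u‖ ^ 2)) :=
          (norm_sum_le _ _).trans <| Finset.sum_le_sum fun x _ =>
            (norm_sum_le _ _).trans <| Finset.sum_le_sum fun u _ => hterm x u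
      _ = δ / 2 * ∑ x, (∑ u, ‖B x u‖) * ‖v x‖ ^ 2 + δ / 2 * ∑ u, (∑ x, ‖B x u‖) * ‖v u‖ ^ 2 := by
          simp only [Finset.sum_add_distrib, ← Finset.mul_sum, Finset.sum_mul]
          congr 2
          exact Finset.sum_comm
      _ ≤ δ / 2 * ∑ x, b * ‖v x‖ ^ 2 + δ / 2 * ∑ u, b * ‖v u‖ ^ 2 := by
          gcongr
          exacts [hrow _, hcol _]
      _ = _ := by rw [← Finset.mul_sum]; ring
  rw [hsplit, Complex.add_re]
  have := (Complex.re_le_norm _).trans herr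
  simp only [hvn] at this
  linarith [hB v]

/-- The Hilbert-Schmidt energy of `ρ ↦ Bρ + ρB*` for a dissipative matrix `B`, in a slowly varying
weight. -/
theorem re_sum_weight_mul_add_mul_le {B : Matrix n n ℂ}
    (hB : ∀ v : n → ℂ, (star v ⬝ᵥ (B *ᵥ v)).re ≤ 0)
    {b δ : ℝ} (hδ : 0 ≤ δ) (hrow : ∀ x, ∑ u, ‖B x u‖ ≤ b) (hcol : ∀ u, ∑ x, ‖B x u‖ ≤ b)
    {w : n → n → ℝ} (hw : ∀ x y, 0 < w x y) (hsymm : ∀ x y, w x y = w y x)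
    (hwB : ∀ x u y, B x u ≠ 0 → |w x y / w u y - 1| ≤ δ) (η : Matrix n n ℂ) :
    (∑ x, ∑ y, (w x y : ℂ) ^ 2 * (star (η x y) * (B * η + η * Bᴴ) x y)).re ≤
      2 * (b * δ) * ∑ x, ∑ y, w x y ^ 2 * ‖η x y‖ ^ 2 := by
  have h1 : (∑ x, ∑ y, (w x y : ℂ) ^ 2 * (star (η x y) * (B * η) x y)).re ≤
      b * δ * ∑ x, ∑ y, w x y ^ 2 * ‖η x y‖ ^ 2 := by
    rw [Finset.sum_comm, Complex.re_sum, Finset.sum_comm (γ := n) (f := fun x y => w x y ^ 2 * _),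
      Finset.mul_sum]
    exact Finset.sum_le_sum fun y _ => re_sum_weight_mulVec_le hB hδ hrow hcol
      (fun x => hw x y) (fun x u h => hwB x u y h) fun x => η x y
  have h2 : (∑ x, ∑ y, (w x y : ℂ) ^ 2 * (star (η x y) * (η * Bᴴ) x y)).re ≤
      b * δ * ∑ x, ∑ y, w x y ^ 2 * ‖η x y‖ ^ 2 := by
    -- Right multiplication by `B*` is, after complex conjugation, `B` acting on the conjugated
    -- rows; the symmetry of `w` makes the same weight condition available.
    rw [Complex.re_sum, Finset.mul_sum]
    refine Finset.sum_le_sum fun x _ => ?_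
    have := re_sum_weight_mulVec_le hB hδ hrow hcol (p := fun y => w x y)
      (fun y => hw x y) (fun y u h => by rw [hsymm x y, hsymm x u]; exact hwB y u x h)
      fun y => star (η x y)
    simp only [norm_star] at this
    refine le_trans (le_of_eq ?_) this
    rw [← Complex.conj_re, map_sum]
    congr 1
    refine Finset.sum_congr rfl fun y _ => ?_
    simp only [map_mul, map_pow, Complex.conj_ofReal, Complex.star_def, Complex.conj_conj]
    congr 2
    simp only [Matrix.mul_apply, Matrix.mulVec, dotProduct, map_sum, map_mul,
      Matrix.conjTranspose_apply, Complex.star_def, Complex.conj_conj]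
    exact Finset.sum_congr rfl fun u _ => mul_comm _ _
  simp only [Matrix.add_apply, mul_add, Finset.sum_add_distrib, Complex.add_re]
  linarith

/-- Weighted resolvent bound for `ρ ↦ Bρ + ρB*`. -/
theorem weighted_resolvent_bound {B : Matrix n n ℂ}
    (hB : ∀ v : n → ℂ, (star v ⬝ᵥ (B *ᵥ v)).re ≤ 0)
    {b δ : ℝ} (hδ : 0 ≤ δ) (hrow : ∀ x, ∑ u, ‖B x u‖ ≤ b) (hcol : ∀ u, ∑ x, ‖B x u‖ ≤ b)
    {w : n → n → ℝ} (hw : ∀ x y, 0 < w x y) (hsymm : ∀ x y, w x y = w y x)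
    (hwB : ∀ x u y, B x u ≠ 0 → |w x y / w u y - 1| ≤ δ) {k l : ℝ} (hk : 0 < k)
    (hkl : k + 2 * (b * δ) ≤ l) {η τ : Matrix n n ℂ}
    (h : (l : ℂ) • η - (B * η + η * Bᴴ) = τ) :
    k ^ 2 * ∑ x, ∑ y, w x y ^ 2 * ‖η x y‖ ^ 2 ≤ ∑ x, ∑ y, w x y ^ 2 * ‖τ x y‖ ^ 2 := by
  have hE := re_sum_weight_mul_add_mul_le hB hδ hrow hcol hw hsymm hwB η
  set S := ∑ x, ∑ y, w x y ^ 2 * ‖η x y‖ ^ 2 with hS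
  set S' := ∑ x, ∑ y, w x y ^ 2 * ‖τ x y‖ ^ 2 with hS'
  have hS0 : 0 ≤ S := Finset.sum_nonneg fun x _ => Finset.sum_nonneg fun y _ => by positivity
  have hBη : B * η + η * Bᴴ = (l : ℂ) • η - τ := by rw [← h]; abel
  have hre : (∑ x, ∑ y, (w x y : ℂ) ^ 2 * (star (η x y) * (B * η + η * Bᴴ) x y)).re =
      l * S - (∑ x, ∑ y, (w x y : ℂ) ^ 2 * (star (η x y) * τ x y)).re := by
    rw [hBη]
    simp only [Matrix.sub_apply, Matrix.smul_apply, mul_sub, Finset.sum_sub_distrib, Complex.sub_re]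
    congr 1
    simp only [hS, Complex.re_sum, Finset.mul_sum]
    refine Finset.sum_congr rfl fun x _ => Finset.sum_congr rfl fun y _ => ?_
    have : (w x y : ℂ) ^ 2 * (star (η x y) * ((l : ℂ) • η x y)) =
        ((l * (w x y ^ 2 * ‖η x y‖ ^ 2) : ℝ) : ℂ) := by
      rw [← Complex.normSq_eq_norm_sq]
      push_cast
      rw [Complex.normSq_eq_conj_mul_self, smul_eq_mul, Complex.star_def]
      ring
    rw [this, Complex.ofReal_re]
  -- Young's inequality with parameter `k`: half of the coercive term `k * S` remains.
  have hτ : (∑ x, ∑ y, (w x y : ℂ) ^ 2 * (star (η x y) * τ x y)).re ≤ k / 2 * S + S' / (2 * k) := by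
    refine (Complex.re_le_norm _).trans ?_
    rw [hS, hS', Finset.mul_sum, Finset.sum_div, ← Finset.sum_add_distrib]
    refine (norm_sum_le _ _).trans (Finset.sum_le_sum fun x _ => ?_)
    rw [Finset.mul_sum, Finset.sum_div, ← Finset.sum_add_distrib]
    refine (norm_sum_le _ _).trans (Finset.sum_le_sum fun y _ => ?_)
    rw [norm_mul, norm_mul, norm_pow, norm_star, Complex.norm_real, Real.norm_of_nonneg (hw x y).le]
    have : ‖η x y‖ * ‖τ x y‖ ≤ k / 2 * ‖η x y‖ ^ 2 + ‖τ x y‖ ^ 2 / (2 * k) := by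
      have e : k / 2 * ‖η x y‖ ^ 2 + ‖τ x y‖ ^ 2 / (2 * k) - ‖η x y‖ * ‖τ x y‖ =
          (k * ‖η x y‖ - ‖τ x y‖) ^ 2 / (2 * k) := by field_simp; ring
      have : 0 ≤ (k * ‖η x y‖ - ‖τ x y‖) ^ 2 / (2 * k) := by positivity
      linarith
    calc _ ≤ w x y ^ 2 * (k / 2 * ‖η x y‖ ^ 2 + ‖τ x y‖ ^ 2 / (2 * k)) := by gcongr
      _ = _ := by ring
  rw [hre] at hE
  have h3 : k * S ≤ k / 2 * S + S' / (2 * k) := by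
    have := mul_le_mul_of_nonneg_right hkl hS0
    linarith
  have h4 : k / 2 * S ≤ S' / (2 * k) := by linarith
  rw [le_div_iff₀ (by positivity)] at h4
  linarith

theorem norm_apply_sq_le_sum (η : Matrix n n ℂ) (x y : n) :
    ‖η x y‖ ^ 2 ≤ ∑ x, ∑ y, ‖η x y‖ ^ 2 :=
  (Finset.single_le_sum (f := fun y => ‖η x y‖ ^ 2) (fun _ _ => by positivity)
    (Finset.mem_univ y)).trans
  (Finset.single_le_sum (f := fun x => ∑ y, ‖η x y‖ ^ 2)
    (fun _ _ => Finset.sum_nonneg fun _ _ => by positivity) (Finset.mem_univ x))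

theorem exists_sum_norm_le (B : Matrix n n ℂ) : ∃ b : ℝ, (∀ x, ∑ u, ‖B x u‖ ≤ b) ∧
    ∀ u, ∑ x, ‖B x u‖ ≤ b := by
  refine ⟨∑ x, ∑ u, ‖B x u‖, fun x => ?_, fun u => ?_⟩
  · exact Finset.single_le_sum (f := fun x => ∑ u, ‖B x u‖)
      (fun _ _ => Finset.sum_nonneg fun _ _ => norm_nonneg _) (Finset.mem_univ x)
  · rw [Finset.sum_comm]
    exact Finset.single_le_sum (f := fun u => ∑ x, ‖B x u‖)
      (fun _ _ => Finset.sum_nonneg fun _ _ => norm_nonneg _) (Finset.mem_univ u)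

/-- A constant weight has `δ = 0`, so the size of the row and column sums is irrelevant. -/
theorem resolvent_bound {B : Matrix n n ℂ} (hB : ∀ v : n → ℂ, (star v ⬝ᵥ (B *ᵥ v)).re ≤ 0)
    {l : ℝ} (hl : 0 < l) {η τ : Matrix n n ℂ} (h : (l : ℂ) • η - (B * η + η * Bᴴ) = τ) :
    l ^ 2 * ∑ x, ∑ y, ‖η x y‖ ^ 2 ≤ ∑ x, ∑ y, ‖τ x y‖ ^ 2 := by
  obtain ⟨b, hrow, hcol⟩ := exists_sum_norm_le B
  simpa using weighted_resolvent_bound hB le_rfl hrow hcol (w := fun _ _ => 1) (by simp) (by simp)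
    (by simp) hl (by simp) h

/-- Pair the eigenvalue equation with `η` in the Hilbert-Schmidt inner product. -/
theorem eigenvalue_re_nonpos {B : Matrix n n ℂ} (hB : ∀ v : n → ℂ, (star v ⬝ᵥ (B *ᵥ v)).re ≤ 0)
    {z : ℂ} {η : Matrix n n ℂ} (hη : η ≠ 0) (h : B * η + η * Bᴴ = z • η) : z.re ≤ 0 := by
  obtain ⟨b, hrow, hcol⟩ := exists_sum_norm_le B
  have hE := re_sum_weight_mul_add_mul_le hB le_rfl hrow hcol (w := fun _ _ => 1) (by simp)
    (by simp) (by simp) η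
  have hpos : 0 < ∑ x, ∑ y, ‖η x y‖ ^ 2 := by
    by_contra! hle
    refine hη (Matrix.ext fun x y => ?_)
    have := (norm_apply_sq_le_sum η x y).trans hle
    simpa using le_antisymm this (by positivity)
  have e : ∑ x, ∑ y, ((1 : ℝ) : ℂ) ^ 2 * (star (η x y) * (B * η + η * Bᴴ) x y) =
      z * ((∑ x, ∑ y, ‖η x y‖ ^ 2 : ℝ) : ℂ) := by
    rw [h]
    push_cast
    simp only [Finset.mul_sum]
    refine Finset.sum_congr rfl fun x _ => Finset.sum_congr rfl fun y _ => ?_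
    rw [Matrix.smul_apply, smul_eq_mul, ← Complex.conj_mul', Complex.star_def]
    ring
  rw [e, Complex.re_mul_ofReal] at hE
  simp only [mul_zero, zero_mul] at hE
  by_contra! hz
  exact absurd hE (not_le.2 (mul_pos hz hpos))

/-- Decay of the solutions of `(T + J) ρ = ε (ρ - ρ₀)`, where `T ρ = Bρ + ρB* - γρ`. -/
theorem norm_apply_le_of_resolvent {B : Matrix n n ℂ}
    (hB : ∀ v : n → ℂ, (star v ⬝ᵥ (B *ᵥ v)).re ≤ 0)
    {b δ : ℝ} (hδ : 0 ≤ δ) (hrow : ∀ x, ∑ u, ‖B x u‖ ≤ b) (hcol : ∀ u, ∑ x, ‖B x u‖ ≤ b)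
    {w : n → n → ℝ} (hw : ∀ x y, 0 < w x y) (hsymm : ∀ x y, w x y = w y x)
    (hwB : ∀ x u y, B x u ≠ 0 → |w x y / w u y - 1| ≤ δ) {γ ε D : ℝ} (hγ : 0 < γ)
    (hγδ : 2 * (b * δ) ≤ γ / 2) (hε : 0 ≤ ε) (hD : 0 ≤ D) {ρ ρ₀ σ : Matrix n n ℂ}
    (hσ : ∑ x, ∑ y, w x y ^ 2 * ‖σ x y‖ ^ 2 ≤ D ^ 2) (hρ₀ : ∑ x, ∑ y, ‖ρ₀ x y‖ ^ 2 ≤ 1)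
    (h : B * ρ + ρ * Bᴴ - (γ : ℂ) • ρ + σ = (ε : ℂ) • (ρ - ρ₀)) (x y : n) :
    ‖ρ x y‖ ≤ 2 * D / γ * (w x y)⁻¹ + ε / γ := by
  have hl : 0 < ε + γ := by linarith
  -- `F` is invertible, so `ρ` splits by linearity into the response to the near-diagonal source `σ`
  -- and the response to `ερ₀`. The first is estimated with the weight, giving up half of `γ`; the
  -- second without it.
  let F : Module.End ℂ (Matrix n n ℂ) :=
    ((ε + γ : ℝ) : ℂ) • LinearMap.id - (LinearMap.mulLeft ℂ B + LinearMap.mulRight ℂ Bᴴ)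
  have hF : ∀ η, F η = ((ε + γ : ℝ) : ℂ) • η - (B * η + η * Bᴴ) := fun η => rfl
  have hinj : Function.Injective F := by
    rw [injective_iff_map_eq_zero]
    intro η hη
    have h1 := resolvent_bound hB hl ((hF η).symm.trans hη)
    simp only [Matrix.zero_apply, norm_zero, ne_eq, OfNat.ofNat_ne_zero, not_false_eq_true,
      zero_pow, Finset.sum_const_zero] at h1
    have h2 : ∑ x, ∑ y, ‖η x y‖ ^ 2 ≤ 0 := by
      by_contra! h3
      exact absurd h1 (not_le.2 (by positivity))
    ext i j
    have h3 : ‖η i j‖ ^ 2 ≤ ∑ x, ∑ y, ‖η x y‖ ^ 2 := norm_apply_sq_le_sum η i j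
    have : ‖η i j‖ = 0 := pow_eq_zero_iff two_ne_zero |>.1
      (le_antisymm (h3.trans h2) (by positivity))
    simpa using this
  have hsurj := LinearMap.injective_iff_surjective.1 hinj
  obtain ⟨η₁, h₁⟩ := hsurj σ
  obtain ⟨η₂, h₂⟩ := hsurj ((ε : ℂ) • ρ₀)
  have hsum : ρ = η₁ + η₂ := by
    apply hinj
    rw [map_add, h₁, h₂, hF]
    have : σ = (ε : ℂ) • (ρ - ρ₀) - (B * ρ + ρ * Bᴴ - (γ : ℂ) • ρ) := by rw [← h]; abel
    rw [this]
    push_cast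
    module
  have b₁ := weighted_resolvent_bound hB hδ hrow hcol hw hsymm hwB (k := γ / 2) (by positivity)
    (by linarith) ((hF η₁).symm.trans h₁)
  have b₂ := resolvent_bound hB hl ((hF η₂).symm.trans h₂)
  have hwxy := hw x y
  have c₁ : ‖η₁ x y‖ ≤ 2 * D / γ * (w x y)⁻¹ := by
    have h1 := norm_apply_sq_le_sum (fun x y => (w x y : ℂ) * η₁ x y) x y
    simp only [norm_mul, mul_pow, Complex.norm_real, Real.norm_eq_abs, sq_abs] at h1
    have h2 : (γ / 2) ^ 2 * (w x y ^ 2 * ‖η₁ x y‖ ^ 2) ≤ D ^ 2 :=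
      (mul_le_mul_of_nonneg_left h1 (by positivity)).trans (b₁.trans hσ)
    have h3 : γ / 2 * (w x y * ‖η₁ x y‖) ≤ D := by
      refine (le_abs_self _).trans (abs_le_of_sq_le_sq ?_ hD)
      rwa [mul_pow, mul_pow]
    rw [← div_eq_mul_inv, div_div, le_div_iff₀ (by positivity)]
    linarith
  have c₂ : ‖η₂ x y‖ ≤ ε / γ := by
    have h1 := norm_apply_sq_le_sum η₂ x y
    have h2 : ∑ x, ∑ y, ‖((ε : ℂ) • ρ₀) x y‖ ^ 2 ≤ ε ^ 2 := by
      simp only [Matrix.smul_apply, smul_eq_mul, norm_mul, mul_pow, Complex.norm_real,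
        Real.norm_eq_abs, sq_abs, ← Finset.mul_sum]
      exact mul_le_of_le_one_right (by positivity) hρ₀
    have h3 : (ε + γ) ^ 2 * ‖η₂ x y‖ ^ 2 ≤ ε ^ 2 :=
      (mul_le_mul_of_nonneg_left h1 (by positivity)).trans (b₂.trans h2)
    have h4 : (ε + γ) * ‖η₂ x y‖ ≤ ε := by
      refine (le_abs_self _).trans (abs_le_of_sq_le_sq ?_ hε)
      rwa [mul_pow]
    rw [le_div_iff₀ hγ]
    nlinarith [norm_nonneg (η₂ x y)]
  rw [hsum, Matrix.add_apply]
  exact (norm_add_le _ _).trans (add_le_add c₁ c₂)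

end Energy

/-! ### Traces and the dephasing terms -/

section Generator

variable {n : Type*} [Fintype n]

theorem Matrix.IsHermitian.re_dotProduct_I_smul_mulVec {H : Matrix n n ℂ} (hH : H.IsHermitian)
    (v : n → ℂ) : (star v ⬝ᵥ ((Complex.I • H) *ᵥ v)).re = 0 := by
  have h : (star v ⬝ᵥ (H *ᵥ v)).im = 0 := by
    rw [← Complex.conj_eq_iff_im, ← Complex.star_def, ← Matrix.star_dotProduct_star, star_star,
      Matrix.star_mulVec, hH.eq, Matrix.dotProduct_mulVec, dotProduct_comm]
  rw [Matrix.smul_mulVec, dotProduct_smul, smul_eq_mul, Complex.I_mul_re, h, neg_zero]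

variable [DecidableEq n]

theorem trace_hamiltonianPart (H ρ : Matrix n n ℂ) : (hamiltonianPart H ρ).trace = 0 := by
  change (-Complex.I • (H * ρ - ρ * H)).trace = 0
  rw [Matrix.trace_smul, Matrix.trace_sub, Matrix.trace_mul_comm, sub_self, smul_zero]

theorem trace_jumpPart (L ρ : Matrix n n ℂ) : (jumpPart L ρ).trace = (Lᴴ * L * ρ).trace := by
  change (L * ρ * Lᴴ).trace = _
  rw [Matrix.trace_mul_cycle]

theorem trace_dissipator (L ρ : Matrix n n ℂ) : (dissipator L ρ).trace = 0 := by
  change (jumpPart L ρ + -(1 / 2 : ℂ) • (Lᴴ * L * ρ + ρ * (Lᴴ * L))).trace = 0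
  rw [Matrix.trace_add, trace_jumpPart, Matrix.trace_smul, Matrix.trace_add,
    Matrix.trace_mul_comm ρ, smul_eq_mul]
  ring

theorem siteProj_conjTranspose_mul_self (k : n) :
    (siteProj k)ᴴ * siteProj k = Matrix.single k k 1 := by
  simp [siteProj]

theorem sum_single_one : ∑ k : n, Matrix.single k k (1 : ℂ) = 1 := by
  ext x y
  simp [Matrix.sum_apply, Matrix.single_apply, Matrix.one_apply, ite_and]

/-- The origin of the gap: dephasing at all sites makes every matrix element decay at the same rate,
independently of the volume. -/
theorem sum_decayPart_siteProj (ρ : Matrix n n ℂ) :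
    (∑ k : n, decayPart (siteProj k)) ρ = -ρ := by
  have h : ∀ k : n, decayPart (siteProj k) ρ =
      -(1 / 2 : ℂ) • (Matrix.single k k 1 * ρ + ρ * Matrix.single k k 1) := fun k => by
    rw [← siteProj_conjTranspose_mul_self]; rfl
  rw [LinearMap.sum_apply]
  simp only [h, ← Finset.smul_sum, Finset.sum_add_distrib, ← Finset.sum_mul, ← Finset.mul_sum,
    sum_single_one]
  rw [one_mul, mul_one]
  module

theorem jumpPart_siteProj_apply (k : n) (ρ : Matrix n n ℂ) (x y : n) :
    jumpPart (siteProj k) ρ x y = if k = x ∧ k = y then ρ k k else 0 := by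
  change (Matrix.single k k (1 : ℂ) * ρ * (Matrix.single k k (1 : ℂ))ᴴ : Matrix n n ℂ) x y = _
  simp [Matrix.single_mul_mul_single, Matrix.single_apply]

end Generator

/-! ### Volume-independent bounds for local terms -/

namespace LocalTerms

variable {d : ℕ} {ι : Type*} {R : ℝ} {N : ℕ} {M : ℝ}

/-- The number of sites in a ball of radius `R`. -/
noncomputable def ballCard (d : ℕ) (R : ℝ) : ℕ := (Metric.closedBall (0 : Site d) R).ncard

theorem card_near_le (Λ : Finset (Site d)) (R : ℝ) (x : Site d) :
    (Finset.univ.filter fun u : Λ => ‖x - u‖ ≤ R).card ≤ ballCard d R := by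
  have hfin : (Metric.closedBall (0 : Site d) R).Finite :=
    (isCompact_closedBall 0 R).finite_of_discrete
  rw [← Set.ncard_coe_finset]
  refine Set.ncard_le_ncard_of_injOn (fun u : Λ => x - (u : Site d)) (fun u hu => ?_)
    (fun u _ v _ huv => Subtype.ext (sub_right_injective huv)) hfin
  simpa using hu

/-- Finite range makes row and column sums independent of `Λ`. -/
theorem sum_near_le {Λ : Finset (Site d)} {f : Λ → ℝ} {R m : ℝ} (hm : 0 ≤ m) (x : Site d)
    (h0 : ∀ u : Λ, ¬ ‖x - u‖ ≤ R → f u = 0) (hf : ∀ u, f u ≤ m) :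
    ∑ u, f u ≤ ballCard d R * m := by
  classical
  rw [← Finset.sum_filter_of_ne (p := fun u : Λ => ‖x - u‖ ≤ R)
    (fun u _ hu => by by_contra h; exact hu (h0 u h))]
  refine (Finset.sum_le_card_nsmul _ _ m fun u _ => hf u).trans ?_
  rw [nsmul_eq_mul]
  exact mul_le_mul_of_nonneg_right (by exact_mod_cast card_near_le Λ R x) hm

/-- A sum of quantities attached to the terms that act on a given site. -/
theorem norm_sum_le_of_mem_supp (T : LocalTerms d ι R N M) (s : Finset ι) (x : Site d) {f : ι → ℂ}
    {m : ℝ} (hm : 0 ≤ m) (h0 : ∀ i, x ∉ T.supp i → f i = 0) (hf : ∀ i, ‖f i‖ ≤ m) :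
    ‖∑ i ∈ s, f i‖ ≤ N * m := by
  classical
  rw [← Finset.sum_filter_of_ne (p := fun i => x ∈ T.supp i)
    (fun i _ hi => by by_contra h; exact hi (h0 i h))]
  refine (norm_sum_le _ _).trans ((Finset.sum_le_card_nsmul _ _ m fun i _ => hf i).trans ?_)
  rw [nsmul_eq_mul]
  refine mul_le_mul_of_nonneg_right ?_ hm
  have h1 : ((s.filter fun i => x ∈ T.supp i : Finset ι) : Set ι).encard ≤ N :=
    (Set.encard_le_encard (fun i hi => (by simpa using hi : i ∈ s ∧ x ∈ T.supp i).2)).trans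
      (T.encard_le x)
  rw [Set.encard_coe_eq_coe_finsetCard] at h1
  exact_mod_cast h1

theorem norm_op_le_abs (T : LocalTerms d ι R N M) (i : ι) (x y : Site d) : ‖T.op i x y‖ ≤ |M| :=
  (T.norm_op_le i x y).trans (le_abs_self M)

theorem norm_sub_le_of_op_ne_zero (T : LocalTerms d ι R N M) {i : ι} {x y : Site d}
    (h : T.op i x y ≠ 0) : ‖x - y‖ ≤ R := by
  have := not_imp_comm.1 (T.op_eq_zero i x y) h
  exact T.diam_le i x this.1 y this.2

variable (T : LocalTerms d ι R N M) (Λ : Finset (Site d))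

theorem norm_sum_onRegion_le (x y : Λ) :
    ‖(∑ i ∈ T.inside Λ, T.onRegion Λ i) x y‖ ≤ N * |M| := by
  rw [Matrix.sum_apply]
  exact T.norm_sum_le_of_mem_supp _ x (abs_nonneg M)
    (fun i hi => T.op_eq_zero i x y fun h => hi h.1) fun i => T.norm_op_le_abs i x y

theorem sum_onRegion_eq_zero {x y : Λ} (h : ¬ ‖(x : Site d) - y‖ ≤ R) :
    (∑ i ∈ T.inside Λ, T.onRegion Λ i) x y = 0 := by
  rw [Matrix.sum_apply]
  exact Finset.sum_eq_zero fun i _ => not_imp_comm.1 T.norm_sub_le_of_op_ne_zero h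

/-- The operator `∑ⱼ Lⱼ* Lⱼ` on the region `Λ`. -/
noncomputable def gram : Matrix Λ Λ ℂ :=
  ∑ j ∈ T.inside Λ, (T.onRegion Λ j)ᴴ * T.onRegion Λ j

theorem conjTranspose_mul_onRegion_eq_zero {j : ι} {x y : Λ}
    (h : ¬ ((x : Site d) ∈ T.supp j ∧ (y : Site d) ∈ T.supp j)) :
    ((T.onRegion Λ j)ᴴ * T.onRegion Λ j) x y = 0 := by
  rw [Matrix.mul_apply]
  refine Finset.sum_eq_zero fun v _ => ?_
  rw [Matrix.conjTranspose_apply]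
  change star (T.op j v x) * T.op j v y = 0
  by_cases hx : (x : Site d) ∈ T.supp j
  · rw [T.op_eq_zero j v y fun hy => h ⟨hx, hy.2⟩, mul_zero]
  · rw [T.op_eq_zero j v x fun hy => hx hy.2, star_zero, zero_mul]

theorem norm_conjTranspose_mul_onRegion_le (j : ι) (x y : Λ) :
    ‖((T.onRegion Λ j)ᴴ * T.onRegion Λ j) x y‖ ≤ ballCard d R * |M| ^ 2 := by
  rw [Matrix.mul_apply]
  refine (norm_sum_le _ _).trans (sum_near_le (by positivity) x (fun v hv => ?_) fun v => ?_)
  · change ‖star (T.op j v x) * T.op j v y‖ = 0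
    rw [norm_sub_rev] at hv
    rw [not_imp_comm.1 T.norm_sub_le_of_op_ne_zero hv, star_zero, zero_mul, norm_zero]
  · change ‖star (T.op j v x) * T.op j v y‖ ≤ _
    rw [norm_mul, norm_star, sq]
    exact mul_le_mul (T.norm_op_le_abs _ _ _) (T.norm_op_le_abs _ _ _) (norm_nonneg _)
      (abs_nonneg M)

theorem norm_gram_le (x y : Λ) : ‖T.gram Λ x y‖ ≤ N * (ballCard d R * |M| ^ 2) := by
  rw [gram, Matrix.sum_apply]
  exact T.norm_sum_le_of_mem_supp _ x (by positivity)
    (fun j hj => T.conjTranspose_mul_onRegion_eq_zero Λ fun h => hj h.1)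
    fun j => T.norm_conjTranspose_mul_onRegion_le Λ j x y

theorem gram_eq_zero {x y : Λ} (h : ¬ ‖(x : Site d) - y‖ ≤ R) : T.gram Λ x y = 0 := by
  rw [gram, Matrix.sum_apply]
  exact Finset.sum_eq_zero fun j _ =>
    T.conjTranspose_mul_onRegion_eq_zero Λ fun hxy => h (T.diam_le j x hxy.1 y hxy.2)

theorem gram_posSemidef : (T.gram Λ).PosSemidef :=
  Matrix.posSemidef_sum _ fun _ _ => Matrix.posSemidef_conjTranspose_mul_self _

/-- `LρL*` lives on the block `S × S` of the support `S` of `L`, however spread out `ρ` is. -/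
theorem jumpPart_onRegion_eq_zero (ρ : Matrix Λ Λ ℂ) (j : ι) {x y : Λ}
    (h : ¬ ‖(x : Site d) - y‖ ≤ R) : jumpPart (T.onRegion Λ j) ρ x y = 0 := by
  change (T.onRegion Λ j * ρ * (T.onRegion Λ j)ᴴ) x y = 0
  by_cases hx : (x : Site d) ∈ T.supp j
  · have hy : (y : Site d) ∉ T.supp j := fun hy => h (T.diam_le j x hx y hy)
    rw [Matrix.mul_apply]
    refine Finset.sum_eq_zero fun v _ => ?_
    rw [Matrix.conjTranspose_apply]
    change _ * star (T.op j y v) = 0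
    rw [T.op_eq_zero j y v fun h' => hy h'.1, star_zero, mul_zero]
  · rw [mul_assoc, Matrix.mul_apply]
    refine Finset.sum_eq_zero fun v _ => ?_
    change T.op j x v * _ = 0
    rw [T.op_eq_zero j x v fun h' => hx h'.1, zero_mul]

end LocalTerms

/-- For `t ≤ 0` this is `e^t + e^{-t} ≥ 2`. It controls the ratio of exponential weights at nearby
sites. -/
theorem Real.abs_exp_sub_one_le_exp_abs (t : ℝ) : |Real.exp t - 1| ≤ Real.exp |t| - 1 := by
  rcases le_total 0 t with h | h
  · rw [abs_of_nonneg h, abs_of_nonneg (by linarith [Real.add_one_le_exp t])]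
  · have h1 : Real.exp t ≤ 1 := Real.exp_le_one_iff.2 h
    rw [abs_of_nonpos h, abs_of_nonpos (by linarith)]
    have h2 : Real.exp t * Real.exp (-t) = 1 := by rw [← Real.exp_add]; simp
    nlinarith [sq_nonneg (Real.exp t - Real.exp (-t)), Real.exp_pos t, Real.exp_pos (-t),
      sq_nonneg (Real.exp t + Real.exp (-t) - 2)]

/-! ### The local Lindbladian: drift and jumps -/

namespace LocalLindbladian

open LocalTerms

variable {d : ℕ} {ι κ : Type*} {R : ℝ} {N : ℕ} {M : ℝ} (𝓛 : LocalLindbladian d ι κ R N M)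
  (G γ : ℝ) (Λ : Finset (Site d))

theorem hamiltonian_isHermitian : (𝓛.hamiltonian Λ).IsHermitian := by
  rw [hamiltonian, Matrix.IsHermitian, Matrix.conjTranspose_sum]
  exact Finset.sum_congr rfl fun i _ => (𝓛.ham_isHermitian i).submatrix _

/-- The matrix `B = -iH - (G/2) ∑ⱼ Lⱼ* Lⱼ` that drives the non-Hermitian evolution. -/
noncomputable def drift : Matrix Λ Λ ℂ :=
  -Complex.I • 𝓛.hamiltonian Λ - ((G / 2 : ℝ) : ℂ) • 𝓛.lind.gram Λ

/-- The sum of the quantum jump terms. -/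
noncomputable def jump : Module.End ℂ (Matrix Λ Λ ℂ) :=
  (G : ℂ) • ∑ j ∈ 𝓛.lind.inside Λ, jumpPart (𝓛.lind.onRegion Λ j)
    + (γ : ℂ) • ∑ k : Λ, jumpPart (siteProj k)

theorem generator_eq : 𝓛.generator G γ Λ = 𝓛.nonHermitian G γ Λ + 𝓛.jump G γ Λ := by
  simp only [generator, nonHermitian, jump, dissipator, Finset.sum_add_distrib, smul_add]
  abel

theorem nonHermitian_apply (ρ : Matrix Λ Λ ℂ) : 𝓛.nonHermitian G γ Λ ρ =
    𝓛.drift G Λ * ρ + ρ * (𝓛.drift G Λ)ᴴ - (γ : ℂ) • ρ := by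
  have h1 : (∑ j ∈ 𝓛.lind.inside Λ, decayPart (𝓛.lind.onRegion Λ j)) ρ =
      -(1 / 2 : ℂ) • (𝓛.lind.gram Λ * ρ + ρ * 𝓛.lind.gram Λ) := by
    rw [LinearMap.sum_apply, gram, Finset.sum_mul, Finset.mul_sum, ← Finset.sum_add_distrib,
      Finset.smul_sum]
    rfl
  have h2 : hamiltonianPart (𝓛.hamiltonian Λ) ρ =
      -Complex.I • (𝓛.hamiltonian Λ * ρ - ρ * 𝓛.hamiltonian Λ) := rfl
  rw [nonHermitian, LinearMap.add_apply, LinearMap.add_apply, LinearMap.smul_apply,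
    LinearMap.smul_apply, sum_decayPart_siteProj, h1, h2, drift]
  simp only [Matrix.conjTranspose_sub, Matrix.conjTranspose_smul, (𝓛.hamiltonian_isHermitian Λ).eq,
    (𝓛.lind.gram_posSemidef Λ).isHermitian.eq, Complex.star_def, map_neg, Complex.conj_I,
    Complex.conj_ofReal, sub_mul, mul_sub, Matrix.smul_mul, Matrix.mul_smul]
  push_cast
  module

theorem re_dotProduct_drift_nonpos (hG : 0 < G) (v : Λ → ℂ) :
    (star v ⬝ᵥ (𝓛.drift G Λ *ᵥ v)).re ≤ 0 := by
  have h1 := (𝓛.hamiltonian_isHermitian Λ).re_dotProduct_I_smul_mulVec v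
  have h2 := (Complex.nonneg_iff.1 ((𝓛.lind.gram_posSemidef Λ).dotProduct_mulVec_nonneg v)).1
  rw [drift, Matrix.sub_mulVec, dotProduct_sub, neg_smul, Matrix.neg_mulVec, dotProduct_neg,
    Complex.sub_re, Complex.neg_re, h1, Matrix.smul_mulVec, dotProduct_smul, smul_eq_mul,
    Complex.re_ofReal_mul]
  nlinarith

theorem drift_eq_zero {x y : Λ} (h : ¬ ‖(x : Site d) - y‖ ≤ R) : 𝓛.drift G Λ x y = 0 := by
  rw [drift, Matrix.sub_apply, Matrix.smul_apply, Matrix.smul_apply, 𝓛.lind.gram_eq_zero Λ h,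
    hamiltonian, 𝓛.ham.sum_onRegion_eq_zero Λ h]
  simp

/-- A bound for the matrix elements of the drift. -/
noncomputable def driftBound (d : ℕ) (R : ℝ) (N : ℕ) (M G : ℝ) : ℝ :=
  N * |M| + G / 2 * (N * (ballCard d R * |M| ^ 2))

theorem norm_drift_le (hG : 0 < G) (x y : Λ) : ‖𝓛.drift G Λ x y‖ ≤ driftBound d R N M G := by
  rw [drift, Matrix.sub_apply, Matrix.smul_apply, Matrix.smul_apply]
  refine (norm_sub_le _ _).trans (add_le_add ?_ ?_)
  · rw [norm_smul, norm_neg, Complex.norm_I, one_mul]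
    exact 𝓛.ham.norm_sum_onRegion_le Λ x y
  · rw [norm_smul, Complex.norm_real, Real.norm_of_nonneg (by positivity)]
    exact mul_le_mul_of_nonneg_left (𝓛.lind.norm_gram_le Λ x y) (by positivity)

theorem driftBound_nonneg (hG : 0 < G) : 0 ≤ driftBound d R N M G := by
  unfold driftBound; positivity

theorem sum_norm_drift_row_le (hG : 0 < G) (x : Λ) :
    ∑ u, ‖𝓛.drift G Λ x u‖ ≤ ballCard d R * driftBound d R N M G :=
  sum_near_le (driftBound_nonneg G hG) x
    (fun u hu => by rw [𝓛.drift_eq_zero G Λ hu, norm_zero]) fun u => 𝓛.norm_drift_le G Λ hG x u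

theorem sum_norm_drift_col_le (hG : 0 < G) (u : Λ) :
    ∑ x, ‖𝓛.drift G Λ x u‖ ≤ ballCard d R * driftBound d R N M G :=
  sum_near_le (driftBound_nonneg G hG) u
    (fun x hx => by rw [norm_sub_rev] at hx; rw [𝓛.drift_eq_zero G Λ hx, norm_zero])
    fun x => 𝓛.norm_drift_le G Λ hG x u

theorem trace_generator (ρ : Matrix Λ Λ ℂ) : (𝓛.generator G γ Λ ρ).trace = 0 := by
  simp only [generator, LinearMap.add_apply, LinearMap.smul_apply, LinearMap.sum_apply,
    Matrix.trace_add, Matrix.trace_smul, Matrix.trace_sum, trace_hamiltonianPart, trace_dissipator,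
    Finset.sum_const_zero, smul_zero, add_zero]

theorem jump_posSemidef (hG : 0 < G) (hγ : 0 < γ) {ρ : Matrix Λ Λ ℂ} (hρ : ρ.PosSemidef) :
    (𝓛.jump G γ Λ ρ).PosSemidef := by
  simp only [jump, LinearMap.add_apply, LinearMap.smul_apply, LinearMap.sum_apply]
  exact ((Matrix.posSemidef_sum _ fun j _ => hρ.mul_mul_conjTranspose_same _).smul
    (by exact_mod_cast hG.le)).add ((Matrix.posSemidef_sum _ fun k _ =>
      hρ.mul_mul_conjTranspose_same _).smul (by exact_mod_cast hγ.le))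

/-- The range is `max R 0` because the dephasing jumps occupy the diagonal even if `R < 0`. -/
theorem jump_eq_zero {ρ : Matrix Λ Λ ℂ} {x y : Λ} (h : ¬ ‖(x : Site d) - y‖ ≤ max R 0) :
    𝓛.jump G γ Λ ρ x y = 0 := by
  have hR : ¬ ‖(x : Site d) - y‖ ≤ R := fun h' => h (h'.trans (le_max_left _ _))
  have hxy : ∀ k : Λ, ¬ (k = x ∧ k = y) := by
    rintro k ⟨rfl, rfl⟩
    simp at h
  simp only [jump, LinearMap.add_apply, LinearMap.smul_apply, LinearMap.sum_apply,
    Matrix.add_apply, Matrix.smul_apply, Matrix.sum_apply, jumpPart_siteProj_apply, if_neg (hxy _),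
    𝓛.lind.jumpPart_onRegion_eq_zero Λ ρ _ hR, Finset.sum_const_zero, smul_zero, add_zero]

/-- A bound for the trace of the quantum jump terms. -/
noncomputable def jumpBound (d : ℕ) (R : ℝ) (N : ℕ) (M G γ : ℝ) : ℝ :=
  G * (ballCard d R * (N * (ballCard d R * |M| ^ 2))) + γ

theorem jumpBound_pos (hG : 0 < G) (hγ : 0 < γ) : 0 < jumpBound d R N M G γ := by
  unfold jumpBound; positivity

/-- By cyclicity the trace is `G tr(∑ L*L ρ) + γ tr ρ`. A Schur test with `|ρ(u,x)| ≤ (ρ(x,x) +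
ρ(u,u))/2` bounds it by a row sum times `tr ρ = 1`, so the volume does not enter. -/
theorem norm_trace_jump_le (hG : 0 < G) (hγ : 0 < γ) {ρ : Matrix Λ Λ ℂ} (hρ : IsState ρ) :
    ‖(𝓛.jump G γ Λ ρ).trace‖ ≤ jumpBound d R N M G γ := by
  set m : ℝ := N * (ballCard d R * |M| ^ 2) with hm
  have htr : (𝓛.jump G γ Λ ρ).trace = (G : ℂ) * (𝓛.lind.gram Λ * ρ).trace + γ := by
    have h1 : ∑ k : Λ, (jumpPart (siteProj k) ρ).trace = 1 := by
      simp only [trace_jumpPart, siteProj_conjTranspose_mul_self]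
      rw [← Matrix.trace_sum, ← Finset.sum_mul, sum_single_one, one_mul, hρ.2]
    have h2 : ∑ j ∈ 𝓛.lind.inside Λ, (jumpPart (𝓛.lind.onRegion Λ j) ρ).trace =
        (𝓛.lind.gram Λ * ρ).trace := by
      simp only [trace_jumpPart]
      rw [← Matrix.trace_sum, ← Finset.sum_mul, gram]
    simp only [jump, LinearMap.add_apply, LinearMap.smul_apply, LinearMap.sum_apply,
      Matrix.trace_add, Matrix.trace_smul, Matrix.trace_sum, h1, h2, smul_eq_mul, mul_one]
  have hd : ∑ x, (ρ x x).re = 1 := by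
    have := congrArg Complex.re hρ.2
    rwa [Matrix.trace, Complex.re_sum] at this
  have hK : ‖(𝓛.lind.gram Λ * ρ).trace‖ ≤ ballCard d R * m := by
    have hrow : ∀ x : Λ, ∑ u, ‖𝓛.lind.gram Λ x u‖ ≤ ballCard d R * m := fun x =>
      sum_near_le (by positivity) x
        (fun u hu => by rw [𝓛.lind.gram_eq_zero Λ hu, norm_zero]) fun u => 𝓛.lind.norm_gram_le Λ x u
    have hcol : ∀ u : Λ, ∑ x, ‖𝓛.lind.gram Λ x u‖ ≤ ballCard d R * m := fun u =>
      sum_near_le (by positivity) u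
        (fun x hx => by rw [norm_sub_rev] at hx; rw [𝓛.lind.gram_eq_zero Λ hx, norm_zero])
        fun x => 𝓛.lind.norm_gram_le Λ x u
    calc ‖(𝓛.lind.gram Λ * ρ).trace‖
        ≤ ∑ x, ∑ u, ‖𝓛.lind.gram Λ x u‖ * ‖ρ u x‖ := by
          rw [Matrix.trace]
          refine (norm_sum_le _ _).trans (Finset.sum_le_sum fun x _ => ?_)
          rw [Matrix.diag_apply, Matrix.mul_apply]
          exact (norm_sum_le _ _).trans (Finset.sum_le_sum fun u _ => norm_mul_le _ _)
      _ ≤ ∑ x, ∑ u, (1 / 2 * (‖𝓛.lind.gram Λ x u‖ * (ρ x x).re) +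
            1 / 2 * (‖𝓛.lind.gram Λ x u‖ * (ρ u u).re)) := by
          refine Finset.sum_le_sum fun x _ => Finset.sum_le_sum fun u _ => ?_
          have := mul_le_mul_of_nonneg_left (hρ.1.norm_apply_le u x)
            (norm_nonneg (𝓛.lind.gram Λ x u))
          linarith
      _ = 1 / 2 * ∑ x, (∑ u, ‖𝓛.lind.gram Λ x u‖) * (ρ x x).re +
            1 / 2 * ∑ u, (∑ x, ‖𝓛.lind.gram Λ x u‖) * (ρ u u).re := by
          simp only [Finset.sum_add_distrib, ← Finset.mul_sum, Finset.sum_mul]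
          congr 2
          exact Finset.sum_comm
      _ ≤ 1 / 2 * ∑ x, ballCard d R * m * (ρ x x).re +
            1 / 2 * ∑ u, ballCard d R * m * (ρ u u).re := by
          gcongr
          exacts [hρ.1.re_diag_nonneg _, hrow _, hρ.1.re_diag_nonneg _, hcol _]
      _ = ballCard d R * m := by rw [← Finset.mul_sum, hd]; ring
  rw [htr, jumpBound]
  refine (norm_add_le _ _).trans (add_le_add ?_ ?_)
  · rw [norm_mul, Complex.norm_real, Real.norm_of_nonneg hG.le]
    exact mul_le_mul_of_nonneg_left hK hG.le
  · rw [Complex.norm_real, Real.norm_of_nonneg hγ.le]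

/-- The evolution preserves states. -/
theorem evolve_generator_isState (hG : 0 < G) (hγ : 0 < γ) {ρ : Matrix Λ Λ ℂ} (hρ : IsState ρ)
    {t : ℝ} (ht : 0 ≤ t) : IsState (evolve (𝓛.generator G γ Λ) t ρ) := by
  -- The term `-γρ` is shared equally between left and right multiplication.
  refine evolve_isState (J := 𝓛.jump G γ Λ)
    (B := 𝓛.drift G Λ - ((γ / 2 : ℝ) : ℂ) • (1 : Matrix Λ Λ ℂ)) (fun σ => ?_)
    (fun σ => 𝓛.jump_posSemidef G γ Λ hG hγ) (𝓛.trace_generator G γ Λ) ht hρ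
  rw [generator_eq, LinearMap.add_apply, nonHermitian_apply]
  simp only [Matrix.conjTranspose_sub, Matrix.conjTranspose_smul, Matrix.conjTranspose_one,
    Complex.star_def, Complex.conj_ofReal, sub_mul, mul_sub, Matrix.smul_mul, Matrix.mul_smul,
    one_mul, mul_one]
  push_cast
  module

theorem re_le_of_mem_spectrum_nonHermitian (hG : 0 < G) {z : ℂ}
    (hz : z ∈ spectrum ℂ (𝓛.nonHermitian G γ Λ)) : z.re ≤ -γ := by
  obtain ⟨η, hη⟩ := (Module.End.hasEigenvalue_iff_mem_spectrum.2 hz).exists_hasEigenvector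
  have h := hη.apply_eq_smul
  rw [nonHermitian_apply, sub_eq_iff_eq_add, ← add_smul] at h
  have := eigenvalue_re_nonpos (𝓛.re_dotProduct_drift_nonpos G Λ hG) hη.2 h
  rw [Complex.add_re, Complex.ofReal_re] at this
  linarith

/-- Exponential decay of the off-diagonal matrix elements of approximate steady states. -/
theorem norm_apply_le_of_generator_eq (hG : 0 < G) (hγ : 0 < γ) {μ : ℝ} (hμ : 0 ≤ μ)
    (hμγ : 2 * (ballCard d R * driftBound d R N M G * (Real.exp (μ * max R 0) - 1)) ≤ γ / 2)
    {ρ ρ₀ : Matrix Λ Λ ℂ} (hρ : IsState ρ) (hρ₀ : IsState ρ₀) {ε : ℝ} (hε : 0 ≤ ε)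
    (h : 𝓛.generator G γ Λ ρ = (ε : ℂ) • (ρ - ρ₀)) (x y : Λ) :
    ‖ρ x y‖ ≤ 2 * (Real.exp (μ * max R 0) * jumpBound d R N M G γ) / γ *
      Real.exp (-μ * ‖(x : Site d) - y‖) + ε / γ := by
  have hJ := jumpBound_pos (d := d) (R := R) (N := N) (M := M) G γ hG hγ
  have hδ : 0 ≤ Real.exp (μ * max R 0) - 1 :=
    sub_nonneg.2 (Real.one_le_exp (mul_nonneg hμ (le_max_right _ _)))
  rw [generator_eq, LinearMap.add_apply, nonHermitian_apply] at h
  have := norm_apply_le_of_resolvent (𝓛.re_dotProduct_drift_nonpos G Λ hG) hδ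
    (𝓛.sum_norm_drift_row_le G Λ hG) (𝓛.sum_norm_drift_col_le G Λ hG)
    (w := fun x y => Real.exp (μ * ‖(x : Site d) - y‖)) (fun _ _ => Real.exp_pos _)
    (fun x y => by rw [norm_sub_rev]) ?_ hγ hμγ hε
    (mul_nonneg (Real.exp_pos (μ * max R 0)).le hJ.le) ?_ ?_ h x y
  · rwa [← Real.exp_neg, ← neg_mul] at this
  · intro x u y hxu
    have hR : ‖(x : Site d) - u‖ ≤ max R 0 :=
      (not_imp_comm.1 (𝓛.drift_eq_zero G Λ) hxu).trans (le_max_left _ _)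
    rw [← Real.exp_sub, ← mul_sub]
    refine (Real.abs_exp_sub_one_le_exp_abs _).trans (sub_le_sub_right (Real.exp_le_exp.2 ?_) 1)
    rw [abs_mul, abs_of_nonneg hμ]
    refine mul_le_mul_of_nonneg_left ((abs_norm_sub_norm_le _ _).trans ?_) hμ
    simpa using hR
  -- On the support of the jump term the weight is at most `e^{μ max R 0}`, and the trace of a
  -- positive matrix bounds its Hilbert-Schmidt norm.
  · have hpos := 𝓛.jump_posSemidef G γ Λ hG hγ hρ.1
    have h1 : ∑ x, ∑ y, ‖𝓛.jump G γ Λ ρ x y‖ ^ 2 ≤ jumpBound d R N M G γ ^ 2 := by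
      refine hpos.sum_norm_sq_le.trans (sq_le_sq' ?_ ?_)
      · linarith [(Complex.nonneg_iff.1 hpos.trace_nonneg).1]
      · exact (Complex.re_le_norm _).trans (𝓛.norm_trace_jump_le G γ Λ hG hγ hρ)
    rw [mul_pow]
    refine le_trans ?_ (mul_le_mul_of_nonneg_left h1 (sq_nonneg _))
    simp only [Finset.mul_sum]
    refine Finset.sum_le_sum fun x _ => Finset.sum_le_sum fun y _ => ?_
    by_cases hxy : ‖(x : Site d) - y‖ ≤ max R 0
    · gcongr
    · simp [𝓛.jump_eq_zero G γ Λ hxy]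
  · have := hρ₀.1.sum_norm_sq_le
    rwa [hρ₀.2, Complex.one_re, one_pow] at this

end LocalLindbladian

/-! ### Choice of constants and conclusion -/

theorem mainTheorem12 (d : ℕ) (R : ℝ) (N : ℕ) (M G γ : ℝ) (hG : 0 < G) (hγ : 0 < γ) :
    (∃ g : ℝ, 0 < g ∧
      ∀ (ι : Type u) (κ : Type v) (𝓛 : LocalLindbladian d ι κ R N M) (Λ : Finset (Site d)),
        ∀ z ∈ spectrum ℂ (𝓛.nonHermitian G γ Λ), z.re ≤ -g) ∧
    ∃ C μ : ℝ, 0 < C ∧ 0 < μ ∧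
      (∀ s : ℝ, 0 < s → s < 1 → ∃ Cs : ℝ, 0 < Cs ∧
        ∀ (ι : Type u) (κ : Type v) (𝓛 : LocalLindbladian d ι κ R N M) (Λ : Finset (Site d))
          (ρ₀ : Matrix Λ Λ ℂ), IsState ρ₀ →
          ∀ ε : ℝ, 0 < ε → ε < 1 → ∀ x y : Λ,
            ‖abelAverage (𝓛.generator G γ Λ) ε ρ₀ x y‖ ≤
              C * Real.exp (-μ * ‖(x : Site d) - (y : Site d)‖) + Cs * ε ^ (2 * s - 1)) ∧
      (∀ (ι : Type u) (κ : Type v) (𝓛 : LocalLindbladian d ι κ R N M) (Λ : Finset (Site d))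
          (ρ : Matrix Λ Λ ℂ), IsSteadyState (𝓛.generator G γ Λ) ρ → ∀ x y : Λ,
            ‖ρ x y‖ ≤ C * Real.exp (-μ * ‖(x : Site d) - (y : Site d)‖)) := by
  refine ⟨⟨γ, hγ, fun ι κ 𝓛 Λ z hz => 𝓛.re_le_of_mem_spectrum_nonHermitian G γ Λ hG hz⟩, ?_⟩
  set b : ℝ := LocalTerms.ballCard d R * LocalLindbladian.driftBound d R N M G with hb
  have hb0 : 0 ≤ b := mul_nonneg (Nat.cast_nonneg _) (LocalLindbladian.driftBound_nonneg G hG)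
  -- The weight error vanishes as `μ → 0`, so a small `μ` keeps it below half the gap; only the
  -- fixed parameters enter.
  obtain ⟨μ, hμ, hμγ⟩ : ∃ μ : ℝ, 0 < μ ∧ 2 * (b * (Real.exp (μ * max R 0) - 1)) ≤ γ / 2 := by
    have hc : Filter.Tendsto (fun μ : ℝ => 2 * (b * (Real.exp (μ * max R 0) - 1)))
        (nhdsWithin 0 (Set.Ioi 0)) (nhds 0) := by
      have : Continuous fun μ : ℝ => 2 * (b * (Real.exp (μ * max R 0) - 1)) := by fun_prop
      simpa using (this.tendsto 0).mono_left nhdsWithin_le_nhds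
    obtain ⟨μ, hμ1, hμ2⟩ := ((hc.eventually (gt_mem_nhds (half_pos hγ))).and
      self_mem_nhdsWithin).exists
    exact ⟨μ, hμ2, hμ1.le⟩
  have hJ := LocalLindbladian.jumpBound_pos (d := d) (R := R) (N := N) (M := M) G γ hG hγ
  refine ⟨_, μ, div_pos (mul_pos two_pos (mul_pos (Real.exp_pos (μ * max R 0)) hJ)) hγ, hμ,
    fun s _ hs => ⟨γ⁻¹, inv_pos.2 hγ, fun ι κ 𝓛 Λ ρ₀ hρ₀ ε hε hε1 x y => ?_⟩,
    fun ι κ 𝓛 Λ ρ hρ x y => ?_⟩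
  · obtain ⟨hst, heq⟩ := abelAverage_isState_and_map
      (fun t ht => 𝓛.evolve_generator_isState G γ Λ hG hγ hρ₀ ht) hε
    refine (𝓛.norm_apply_le_of_generator_eq G γ Λ hG hγ hμ.le hμγ hst hρ₀ hε.le heq x y).trans
      (add_le_add_right ?_ _)
    rw [div_eq_inv_mul]
    refine mul_le_mul_of_nonneg_left ?_ (inv_pos.2 hγ).le
    -- `2s - 1 < 1` and `ε < 1`.
    calc ε = ε ^ (1 : ℝ) := (Real.rpow_one ε).symm
      _ ≤ ε ^ (2 * s - 1) := Real.rpow_le_rpow_of_exponent_ge hε hε1.le (by linarith)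
  -- A steady state is the case `ε = 0`, with `ρ` itself as initial state.
  · have := 𝓛.norm_apply_le_of_generator_eq G γ Λ hG hγ hμ.le hμγ hρ.1 hρ.1 le_rfl
      (by rw [hρ.2]; simp) x y
    simpa using this
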